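/- Setting. All tangles have four marked points (NW, NE, SW, SE) on every boundary circle. A diagram $T$ of an $n$-punctured ball tangle ($n\ge 0$) is a planar diagram of arcs and circles with finitely many crossings in a disk with $n$ round holes, numbered $1,\dots,n$, whose arcs end exactly at the marked points of the outer circle and of the $n$ holes. For $r\in\{1,2\}$ and $\alpha\in\{1,2\}^n$, let $T_{r\alpha}$ be the link diagram obtained by filling, for each $m$, the $m$-th hole with the crossingless tangle that joins NW–SW and NE–SE if $\alpha_m=1$, and NW–NE and SW–SE if $\alpha_m=2$, and then closing up the outer circle outside the disk by arcs that join NW–NE and SW–SE if $r=1$ (numerator closure), and NW–SW and NE–SE if $r=2$ (denominator closure). For a link diagram $L$ let $$\langle L\rangle=\sum_{\sigma}A^{\alpha(\sigma)-\beta(\sigma)}(-A^2-A^{-2})^{d(\sigma)-1},\qquad A=e^{i\pi/4},$$ be its Kauffman bracket at $A=e^{i\pi/4}$; the sum is over all states $\sigma$ of $L$, $\alpha(\sigma)$ and $\beta(\sigma)$ are the numbers of $A$- and $B$-splittings of $\sigma$, $d(\sigma)$ is the number of circles of the split diagram, and $0^0=1$. Let $\alpha^n_1<\dots<\alpha^n_{2^n}$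 be the elements of $\{1,2\}^n$ in dictionary order and let $t_k$ be the number of coordinates of $\alpha^n_k$ equal to $2$. Let $X(T)$ be the $2\times 2^n$ complex matrix whose $k$-th column is $(-i)^{t_k}\begin{pmatrix}\langle T_{1\alpha^n_k}\rangle\\ i\,\langle T_{2\alpha^n_k}\rangle\end{pmatrix}$, and put $$F^n(T)=\{zX(T) : z\in\mathbb C,\ z^8=1\}\cap M_{2\times 2^n}(\mathbb Z).$$ For an integer matrix $M$ write $[M]=\{M,-M\}$. The horizontal connect sum $T^{(1)}+_hT^{(2)}$ places $T^{(1)}$ to the left of $T^{(2)}$ and joins NE and SE of $T^{(1)}$ to NW and SW of $T^{(2)}$, respectively. The vertical connect sum $T^{(1)}+_vT^{(2)}$ places $T^{(1)}$ above $T^{(2)}$ and joins SW and SE of $T^{(1)}$ to NW and NE of $T^{(2)}$, respectively. In both sums the holes of $T^{(1)}$ are numbered first, followed by those of $T^{(2)}$. Theorem 3.9. Let $k_1,k_2\ge 0$, and let $T^{(1)}$ and $T^{(2)}$ be diagrams of $k_1$- and $k_2$-punctured ball tangles. If $$F^{k_1}(T^{(1)})=\left[\begin{pmatrix}a_{11}&\cdots&a_{1\,2^{k_1}}\\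 a_{21}&\cdots&a_{2\,2^{k_1}}\end{pmatrix}\right],\qquad F^{k_2}(T^{(2)})=\left[\begin{pmatrix}b_{11}&\cdots&b_{1\,2^{k_2}}\\ b_{21}&\cdots&b_{2\,2^{k_2}}\end{pmatrix}\right]$$ with integers $a_{ri}$, $b_{rj}$, then: (1) $F^{k_1+k_2}(T^{(1)}+_hT^{(2)})$ is the class $[M]$ of the $2\times 2^{k_1+k_2}$ matrix $M$ with columns $\begin{pmatrix}a_{1i}b_{2j}+a_{2i}b_{1j}\\ a_{2i}b_{2j}\end{pmatrix}$, (2) $F^{k_1+k_2}(T^{(1)}+_vT^{(2)})$ is the class $[M']$ of the $2\times 2^{k_1+k_2}$ matrix $M'$ with columns $\begin{pmatrix}a_{1i}b_{1j}\\ a_{2i}b_{1j}+a_{1i}b_{2j}\end{pmatrix}$, where in both cases the columns are listed with $i=1,\dots,2^{k_1}$ varying slowest: the column for $(i,j)$ is column number $2^{k_2}(i-1)+j$, $1\le j\le 2^{k_2}$. -/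

import Mathlib

namespace PuncturedTangle

/-- One of the four marked points of a boundary circle, written as `(row, column)`:
row `0` is the top, row `1` the bottom, column `0` the left, column `1` the right.
So `(0,0), (0,1), (1,0), (1,1)` are NW, NE, SW, SE. -/
abbrev Corner : Type := Fin 2 × Fin 2

/-- The next corner in the clockwise direction: NW, NE, SE, SW, NW. -/
def Corner.cw (p : Corner) : Corner := (p.2, Fin.rev p.1)

/-- The next corner in the counterclockwise direction: NW, SW, SE, NE, NW. -/
def Corner.ccw (p : Corner) : Corner := (Fin.rev p.2, p.1)

/-! ### Link diagrams -/

/-- The ends of edges at the vertices of a link diagram. The vertices are the crossings, with four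
ends each, and the joints, with two ends each.  A joint is a mere subdivision point of a strand.

The ends at a crossing are numbered `0, 1, 2, 3` counterclockwise; the under-strand
joins `0` and `2`, the over-strand joins `1` and `3`. -/
inductive LinkDart (C J : Type) : Type
  | crossing (c : C) (k : Fin 4)
  | joint (j : J) (b : Fin 2)

/-- A link diagram, as a planar-diagram code: a finite set of crossings, a finite set of joints, and
the edges, which match the ends at the vertices in pairs. A circle without crossings
is recorded by means of joints on it. -/
structure LinkDiagram where
  Crossing : Type
  Joint : Type
  [fintypeCrossing : Fintype Crossing]
  [decEqCrossing : DecidableEq Crossing]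
  [finiteJoint : Finite Joint]
  edge : LinkDart Crossing Joint → LinkDart Crossing Joint
  edge_edge : ∀ d, edge (edge d) = d
  edge_ne : ∀ d, edge d ≠ d

attribute [instance] LinkDiagram.fintypeCrossing LinkDiagram.decEqCrossing LinkDiagram.finiteJoint

namespace LinkDiagram

/-- A state chooses a splitting for every crossing: `true` is type `A`, `false` is type `B`. -/
abbrev State (L : LinkDiagram) : Type := L.Crossing → Bool

/-- How the ends at a crossing are joined after splitting.  Turning the over-strand `1,3`
counterclockwise sweeps the regions between `1` and `2` and between `3` and `0`: these are the
`A`-regions. The `A`-splitting opens a channel between them and so joins `0` with `1` and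
`2` with `3`; the `B`-splitting joins `1` with `2` and `3` with `0`. -/
def split (isA : Bool) : Fin 4 → Fin 4 :=
  if isA then ![1, 0, 3, 2] else ![3, 2, 1, 0]

/-- How the ends at each vertex are joined in the diagram `L_σ` without crossings. -/
def smooth (L : LinkDiagram) (σ : L.State) :
    LinkDart L.Crossing L.Joint → LinkDart L.Crossing L.Joint
  | .crossing c k => .crossing c (split (σ c) k)
  | .joint j b => .joint j (Fin.rev b)

/-- The number `d(σ)` of circles of `L_σ`: the classes of the equivalence relation generated by
following an edge and by passing through a vertex. -/
noncomputable def circles (L : LinkDiagram) (σ : L.State) : ℕ :=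
  Nat.card (Quot fun d e => e = L.edge d ∨ e = L.smooth σ d)

/-- The Kauffman bracket with variable `A`:
the sum over all states of `A ^ α(σ) * (A⁻¹) ^ β(σ) * (-A² - A⁻²) ^ (d(σ) - 1)`,
with `α(σ)` and `β(σ)` the numbers of `A`-splittings and of `B`-splittings.
(A non-empty diagram has `d(σ) ≥ 1`.) -/
noncomputable def bracketAt (L : LinkDiagram) (A : ℂ) : ℂ :=
  ∑ σ : L.State,
    A ^ (Finset.univ.filter fun c => σ c = true).card *
      (A⁻¹) ^ (Finset.univ.filter fun c => σ c = false).card *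
        (-A ^ 2 - (A⁻¹) ^ 2) ^ (L.circles σ - 1)

/-- The Kauffman bracket at `A = exp (i π / 4)`. -/
noncomputable def bracket (L : LinkDiagram) : ℂ :=
  L.bracketAt (Complex.exp (Complex.I * Real.pi / 4))

end LinkDiagram

/-! ### Diagrams of punctured ball tangles -/

/-- The ends of edges at the vertices of the diagram of an `n`-punctured ball tangle: at the four
marked points of the outer boundary circle, at the four marked points of each hole, at the
crossings, and at the joints, with the conventions of `LinkDart`. -/
inductive Dart (n : ℕ) (C J : Type) : Type
  | outer (p : Corner)
  | hole (i : Fin n) (p : Corner)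
  | crossing (c : C) (k : Fin 4)
  | joint (j : J) (b : Fin 2)

/-- A code for the diagram of an `n`-punctured ball tangle with four marked points on
each boundary sphere: its crossings, its joints and the matching of ends by the edges.
The diagrams drawn in the plane are those that satisfy `IsPlanar`; their codes record everything
that brackets and sums depend on. -/
structure TangleDiagram (n : ℕ) where
  Crossing : Type
  Joint : Type
  [fintypeCrossing : Fintype Crossing]
  [decEqCrossing : DecidableEq Crossing]
  [finiteJoint : Finite Joint]
  edge : Dart n Crossing Joint → Dart n Crossing Joint
  edge_edge : ∀ d, edge (edge d) = d
  edge_ne : ∀ d, edge d ≠ d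

attribute [instance] TangleDiagram.fintypeCrossing TangleDiagram.decEqCrossing
  TangleDiagram.finiteJoint

/-- The counterclockwise rotation of the ends about each vertex, when each hole and the outside of
the outer circle are shrunk to vertices on the sphere.  Counterclockwise about the
point at infinity is clockwise along the outer circle. -/
def rotation {n : ℕ} {C J : Type} : Dart n C J → Dart n C J
  | .outer p => .outer p.cw
  | .hole i p => .hole i p.ccw
  | .crossing c k => .crossing c (k + 1)
  | .joint j b => .joint j (Fin.rev b)

/-- The number of cycles of a permutation `f` of a finite set. -/
noncomputable def numCycles {D : Type} (f : D → D) : ℕ :=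
  Nat.card (Quot fun d e => e = f d)

namespace TangleDiagram

variable {n k₁ k₂ : ℕ}

/-- The diagram can be drawn in the plane with the prescribed cyclic orders at all vertices: the
map on a closed surface that is given by the rotations and the edges has genus zero,
`V - E + F = 2 c`, with `c` the number of connected components. -/
def IsPlanar (T : TangleDiagram n) : Prop :=
  numCycles (rotation (n := n) (C := T.Crossing) (J := T.Joint)) +
      numCycles (fun d => rotation (T.edge d)) =
    numCycles T.edge + 2 * Nat.card (Quot fun d e => e = T.edge d ∨ e = rotation d)

/-- Two strands without crossing that join the four corners in pairs, as two joints.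
For `false` the corners of the same row are joined, for `true` those of the same column.
A corner goes to the name of its strand and of its end there. -/
def pairCorners (sameColumn : Bool) : Corner ≃ Fin 2 × Fin 2 :=
  if sameColumn then Equiv.prodComm _ _ else Equiv.refl _

/-- The renaming of ends when the outer circle is closed up and the holes are filled.
Label `0 : Fin 2` stands for the label 1 of numerator closure and of the first fundamental tangle,
`1 : Fin 2` for the label 2 of denominator closure and of the second fundamental tangle.
* The numerator closure joins NW with NE and SW with SE; the denominator closure joins NW with SW
  and NE with SE.
* The first fundamental tangle joins NW with SW and NE with SE (its numerator
  closure is one circle); the second one joins NW with NE and SW with SE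
  (its denominator closure is one circle). -/
def closeDart {C J : Type} (r : Fin 2) (α : Fin n → Fin 2) :
    Dart n C J ≃ LinkDart C (J ⊕ (Fin n × Fin 2) ⊕ Fin 2) where
  toFun
    | .outer p =>
        .joint (.inr (.inr (pairCorners (r == 1) p).1)) (pairCorners (r == 1) p).2
    | .hole i p =>
        .joint (.inr (.inl (i, (pairCorners (α i == 0) p).1))) (pairCorners (α i == 0) p).2
    | .crossing c k => .crossing c k
    | .joint j b => .joint (.inl j) b
  invFun
    | .joint (.inr (.inr s)) b => .outer ((pairCorners (r == 1)).symm (s, b))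
    | .joint (.inr (.inl (i, s))) b => .hole i ((pairCorners (α i == 0)).symm (s, b))
    | .crossing c k => .crossing c k
    | .joint (.inl j) b => .joint j b
  left_inv := by rintro (p | ⟨i, p⟩ | ⟨c, k⟩ | ⟨j, b⟩) <;> simp
  right_inv := by rintro (⟨c, k⟩ | ⟨(j | ⟨i, s⟩ | s), b⟩) <;> simp

/-- The link diagram `T_{r α}`: the numerator (`r = 0`) or denominator (`r = 1`) closure of
the diagram `T` with its `i`-th hole filled by the fundamental tangle with label `α i`. -/
def closure (T : TangleDiagram n) (r : Fin 2) (α : Fin n → Fin 2) : LinkDiagram where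
  Crossing := T.Crossing
  Joint := T.Joint ⊕ (Fin n × Fin 2) ⊕ Fin 2
  edge d := closeDart r α (T.edge ((closeDart r α).symm d))
  edge_edge d := by simp [T.edge_edge]
  edge_ne d h := T.edge_ne ((closeDart r α).symm d) ((Equiv.eq_symm_apply _).2 h)

/-- The renaming of ends in the horizontal connect sum.  The first diagram is on the left.
Its NE and SE corners are glued to the NW and SW corners of the second one, and
become joints. The holes of the first diagram come first. -/
def glueHorizontal {C₁ J₁ C₂ J₂ : Type} :
    Dart k₁ C₁ J₁ ⊕ Dart k₂ C₂ J₂ ≃ Dart (k₁ + k₂) (C₁ ⊕ C₂) ((J₁ ⊕ J₂) ⊕ Fin 2) where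
  toFun
    | .inl (.outer (r, 0)) => .outer (r, 0)
    | .inl (.outer (r, 1)) => .joint (.inr r) 0
    | .inl (.hole i p) => .hole (Fin.castAdd k₂ i) p
    | .inl (.crossing c k) => .crossing (.inl c) k
    | .inl (.joint j b) => .joint (.inl (.inl j)) b
    | .inr (.outer (r, 0)) => .joint (.inr r) 1
    | .inr (.outer (r, 1)) => .outer (r, 1)
    | .inr (.hole i p) => .hole (Fin.natAdd k₁ i) p
    | .inr (.crossing c k) => .crossing (.inr c) k
    | .inr (.joint j b) => .joint (.inl (.inr j)) b
  invFun
    | .outer (r, 0) => .inl (.outer (r, 0))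
    | .outer (r, 1) => .inr (.outer (r, 1))
    | .hole i p => Fin.addCases (fun i₁ => .inl (.hole i₁ p)) (fun i₂ => .inr (.hole i₂ p)) i
    | .crossing (.inl c) k => .inl (.crossing c k)
    | .crossing (.inr c) k => .inr (.crossing c k)
    | .joint (.inl (.inl j)) b => .inl (.joint j b)
    | .joint (.inl (.inr j)) b => .inr (.joint j b)
    | .joint (.inr r) 0 => .inl (.outer (r, 1))
    | .joint (.inr r) 1 => .inr (.outer (r, 0))
  left_inv := by
    rintro ((⟨r, c⟩ | ⟨i, p⟩ | ⟨c, k⟩ | ⟨j, b⟩) | (⟨r, c⟩ | ⟨i, p⟩ | ⟨c, k⟩ | ⟨j, b⟩)) <;>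
      first
        | (fin_cases c <;> rfl)
        | simp
  right_inv := by
    rintro (⟨r, c⟩ | ⟨i, p⟩ | ⟨(c | c), k⟩ | ⟨((j | j) | r), b⟩)
    · fin_cases c <;> rfl
    · refine Fin.addCases (fun i => ?_) (fun i => ?_) i <;> simp
    · rfl
    · rfl
    · rfl
    · rfl
    · fin_cases b <;> rfl

/-- The renaming of ends in the vertical connect sum.  The first diagram is on top.
Its SW and SE corners are glued to the NW and NE corners of the second one, and
become joints. The holes of the first diagram come first. -/
def glueVertical {C₁ J₁ C₂ J₂ : Type} :
    Dart k₁ C₁ J₁ ⊕ Dart k₂ C₂ J₂ ≃ Dart (k₁ + k₂) (C₁ ⊕ C₂) ((J₁ ⊕ J₂) ⊕ Fin 2) where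
  toFun
    | .inl (.outer (0, c)) => .outer (0, c)
    | .inl (.outer (1, c)) => .joint (.inr c) 0
    | .inl (.hole i p) => .hole (Fin.castAdd k₂ i) p
    | .inl (.crossing c k) => .crossing (.inl c) k
    | .inl (.joint j b) => .joint (.inl (.inl j)) b
    | .inr (.outer (0, c)) => .joint (.inr c) 1
    | .inr (.outer (1, c)) => .outer (1, c)
    | .inr (.hole i p) => .hole (Fin.natAdd k₁ i) p
    | .inr (.crossing c k) => .crossing (.inr c) k
    | .inr (.joint j b) => .joint (.inl (.inr j)) b
  invFun
    | .outer (0, c) => .inl (.outer (0, c))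
    | .outer (1, c) => .inr (.outer (1, c))
    | .hole i p => Fin.addCases (fun i₁ => .inl (.hole i₁ p)) (fun i₂ => .inr (.hole i₂ p)) i
    | .crossing (.inl c) k => .inl (.crossing c k)
    | .crossing (.inr c) k => .inr (.crossing c k)
    | .joint (.inl (.inl j)) b => .inl (.joint j b)
    | .joint (.inl (.inr j)) b => .inr (.joint j b)
    | .joint (.inr c) 0 => .inl (.outer (1, c))
    | .joint (.inr c) 1 => .inr (.outer (0, c))
  left_inv := by
    rintro ((⟨r, c⟩ | ⟨i, p⟩ | ⟨c, k⟩ | ⟨j, b⟩) | (⟨r, c⟩ | ⟨i, p⟩ | ⟨c, k⟩ | ⟨j, b⟩)) <;>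
      first
        | (fin_cases r <;> rfl)
        | simp
  right_inv := by
    rintro (⟨r, c⟩ | ⟨i, p⟩ | ⟨(c | c), k⟩ | ⟨((j | j) | r), b⟩)
    · fin_cases r <;> rfl
    · refine Fin.addCases (fun i => ?_) (fun i => ?_) i <;> simp
    · rfl
    · rfl
    · rfl
    · rfl
    · fin_cases b <;> rfl

/-- The (outer) horizontal connect sum `T₁ +_h T₂`. -/
def hsum (T₁ : TangleDiagram k₁) (T₂ : TangleDiagram k₂) : TangleDiagram (k₁ + k₂) where
  Crossing := T₁.Crossing ⊕ T₂.Crossing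
  Joint := (T₁.Joint ⊕ T₂.Joint) ⊕ Fin 2
  edge d := glueHorizontal (Sum.map T₁.edge T₂.edge (glueHorizontal.symm d))
  edge_edge d := by
    rcases h : glueHorizontal.symm d with e | e <;>
      simp [T₁.edge_edge, T₂.edge_edge, ← (Equiv.symm_apply_eq _).1 h]
  edge_ne d hd := by
    rw [← Equiv.eq_symm_apply] at hd
    rcases h : glueHorizontal.symm d with e | e <;> rw [h] at hd
    · exact T₁.edge_ne e (Sum.inl.inj hd)
    · exact T₂.edge_ne e (Sum.inr.inj hd)

/-- The (outer) vertical connect sum `T₁ +_v T₂`. -/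
def vsum (T₁ : TangleDiagram k₁) (T₂ : TangleDiagram k₂) : TangleDiagram (k₁ + k₂) where
  Crossing := T₁.Crossing ⊕ T₂.Crossing
  Joint := (T₁.Joint ⊕ T₂.Joint) ⊕ Fin 2
  edge d := glueVertical (Sum.map T₁.edge T₂.edge (glueVertical.symm d))
  edge_edge d := by
    rcases h : glueVertical.symm d with e | e <;>
      simp [T₁.edge_edge, T₂.edge_edge, ← (Equiv.symm_apply_eq _).1 h]
  edge_ne d hd := by
    rw [← Equiv.eq_symm_apply] at hd
    rcases h : glueVertical.symm d with e | e <;> rw [h] at hd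
    · exact T₁.edge_ne e (Sum.inl.inj hd)
    · exact T₂.edge_ne e (Sum.inr.inj hd)

end TangleDiagram

/-! ### The invariant -/

/-- The `i`-th element, `i = 0, …, 2 ^ n - 1`, of the set of `n`-tuples of labels in the
dictionary order: the first coordinate is the first label for the first half of the tuples, and the
second label for the second half. -/
def dictTuple : (n : ℕ) → ℕ → (Fin n → Fin 2)
  | 0, _ => Fin.elim0
  | n + 1, i => Fin.cons (if i < 2 ^ n then 0 else 1) (dictTuple n (i % 2 ^ n))

/-- The entry `t_i`, `i = 0, …, 2 ^ n - 1`, of the sequence `a_n`, where `a_0 = (0)` and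
`a_{n+1} = (t_0, …, t_{2^n - 1}, t_0 + 1, …, t_{2^n - 1} + 1)` if `a_n = (t_0, …, t_{2^n - 1})`. -/
def tSeq : ℕ → ℕ → ℕ
  | 0, _ => 0
  | n + 1, i => if i < 2 ^ n then tSeq n i else tSeq n (i - 2 ^ n) + 1

/-- The complex matrix `X(T)` with first row `(-i) ^ t_k * ⟨T_{1 α_k}⟩` and
second row `(-i) ^ t_k * i * ⟨T_{2 α_k}⟩`. -/
noncomputable def bracketMatrix {n : ℕ} (T : TangleDiagram n) :
    Matrix (Fin 2) (Fin (2 ^ n)) ℂ :=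
  Matrix.of fun r k =>
    (-Complex.I) ^ tSeq n k * Complex.I ^ (r : ℕ) * (T.closure r (dictTuple n k)).bracket

/-- The class `[M] = {M, -M}` of an integer matrix modulo multiplication by `±1`. -/
def pmClass {m n : ℕ} (M : Matrix (Fin m) (Fin n) ℤ) : Set (Matrix (Fin m) (Fin n) ℤ) :=
  {M, -M}

/-- The invariant `F^n(T)`: the set of the integer matrices among the multiples `z X(T)` of `X(T)`
by eighth roots of unity `z`. -/
noncomputable def tangleInvariant {n : ℕ} (T : TangleDiagram n) :
    Set (Matrix (Fin 2) (Fin (2 ^ n)) ℤ) :=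
  {M | ∃ z : ℂ, z ^ 8 = 1 ∧ M.map (fun x : ℤ => (x : ℂ)) = z • bracketMatrix T}

/-- The position of a column in the listing `((·)_j)_i`, in which the index `i` of the
first matrix varies slowest: the column with number `2 ^ k₂ * i + j` goes to `(i, j)`. -/
def columnPair (k₁ k₂ : ℕ) : Fin (2 ^ (k₁ + k₂)) ≃ Fin (2 ^ k₁) × Fin (2 ^ k₂) :=
  (finCongr (pow_add 2 k₁ k₂)).trans finProdFinEquiv.symm

end PuncturedTangle

/-! At `A = exp (i π / 4)` the loop value `-A² - A⁻²` is zero, so a bracket is the sum of the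
crossing weights over the states that consist of one circle. A state of a connect sum is a pair of
states and its weight is the product of theirs; what remains is to decide when a closed-up glued
state is one circle.

After the holes are filled and all crossings split, a planar tangle consists of two strands, which
join the corners along the rows or along the columns, and possibly loops. Its numerator closure is
one circle exactly when there are no loops and the strands follow the columns; for the denominator
closure they must follow the rows. For a horizontal sum of two such tangles, the numerator closure
is one circle iff neither part has loops and exactly one part has its strands along the rows; the
denominator closure is one circle iff neither has loops and both follow the rows. Writing N and D
for the brackets of the closures and summing over states gives N(T₁ +_h T₂) = N(T₁) D(T₂) + D(T₁)
N(T₂) and D(T₁ +_h T₂) = D(T₁) D(T₂) (`bracket_hsum_zero`, `bracket_hsum_one`). The vertical sum is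
the same with rows and columns exchanged.

Planarity is needed to exclude strands between diagonal corners. Genus zero yields a checkerboard
colouring (`exists_coloring`); the two ends of a strand have opposite colours, but diagonal corners
have the same colour (`twoStrands_of_coloring`).

Connectivity is handled through Boolean functions that are constant on strands and circles: they
restrict to the summands, and glue when they agree along the seam.

Finally, the dictionary order is the binary order, so labels and exponents split with the column
index, and two integer matrices that differ by an eighth root of unity differ by a sign
(`tangleInvariant_eq_pmClass`). -/

namespace PuncturedTangle

/-! ### Invariant functions and gluing -/

/-- The Boolean functions that are constant along the orbits of `e` and `s`. -/
def invariantFunctions {D : Type} (e s : D → D) : Set (D → Bool) :=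
  {φ | (∀ d, φ (e d) = φ d) ∧ ∀ d, φ (s d) = φ d}

/-- The only functions of `I` that agree at the two corners of each row are the constant ones. -/
def Joined {D : Type} (I : Set (D → Bool)) (κ : Corner → D) : Prop :=
  ∀ φ ∈ I, (∀ r, φ (κ (r, 0)) = φ (κ (r, 1))) → ∀ d d', φ d = φ d'

/-- The functions of `I` identify the corners of each row, but not the two rows. -/
def RowStrands {D : Type} (I : Set (D → Bool)) (κ : Corner → D) : Prop :=
  (∀ φ ∈ I, ∀ r, φ (κ (r, 0)) = φ (κ (r, 1))) ∧
    ∃ φ ∈ I, φ (κ (0, 0)) = true ∧ φ (κ (1, 0)) = false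

/-- The corners are joined in pairs, along the rows or along the columns. -/
def TwoStrands {D : Type} (I : Set (D → Bool)) (κ : Corner → D) : Prop :=
  RowStrands I κ ∨ RowStrands I (κ ∘ Prod.swap)

/-- A function of `I` that is constant on the corners is constant. -/
def NoLoops {D : Type} (I : Set (D → Bool)) (κ : Corner → D) : Prop :=
  ∀ φ ∈ I, (∀ p q, φ (κ p) = φ (κ q)) → ∀ d d', φ d = φ d'

section Gluing

variable {D : Type} {I : Set (D → Bool)} {κ : Corner → D}

theorem TwoStrands.swap (h : TwoStrands I κ) : TwoStrands I (κ ∘ Prod.swap) := by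
  rcases h with h | h
  · exact Or.inr (by simpa [Function.comp_assoc] using h)
  · exact Or.inl h

theorem noLoops_swap : NoLoops I (κ ∘ Prod.swap) ↔ NoLoops I κ := by
  refine forall₂_congr fun φ _ => imp_congr_left ⟨fun h p q => ?_, fun h p q => h _ _⟩
  simpa using h p.swap q.swap

theorem RowStrands.not_swap (h : RowStrands I κ) : ¬ RowStrands I (κ ∘ Prod.swap) := by
  obtain ⟨-, φ, hφ, h₁, h₂⟩ := h
  intro h'
  have := h'.1 φ hφ 0
  simp_all

/-- Strands along the rows, closed along the rows, leave the two rows disconnected. Strands along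
the columns become a single circle through all four corners, and then only a loop could be missed.
-/
theorem TwoStrands.joined_iff (h : TwoStrands I κ) :
    Joined I κ ↔ NoLoops I κ ∧ RowStrands I (κ ∘ Prod.swap) := by
  constructor
  · intro hJ
    refine ⟨fun φ hφ hc => hJ φ hφ fun r => hc _ _, h.resolve_left fun hr => ?_⟩
    obtain ⟨φ, hφ, h₁, h₂⟩ := hr.2
    have := hJ φ hφ (hr.1 φ hφ) (κ (0, 0)) (κ (1, 0))
    simp_all
  · rintro ⟨hN, hs⟩ φ hφ hr
    refine hN φ hφ ?_
    have h0 := hs.1 φ hφ 0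
    have h1 := hs.1 φ hφ 1
    have r0 := hr 0
    have r1 := hr 1
    simp only [Function.comp, Prod.swap_prod_mk] at h0 h1
    simp only [Prod.forall, Fin.forall_fin_two]
    simp_all

theorem TwoStrands.joined_swap_iff (h : TwoStrands I κ) :
    Joined I (κ ∘ Prod.swap) ↔ NoLoops I κ ∧ RowStrands I κ := by
  have := h.swap.joined_iff
  rwa [noLoops_swap, Function.comp_assoc, Prod.swap_swap_eq, Function.comp_id] at this

/-- The two closures require strands in different directions. This makes the two alternatives for a
glued state exclusive, so that their indicators add. -/
theorem TwoStrands.not_joined_and (h : TwoStrands I κ) :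
    ¬ (Joined I κ ∧ Joined I (κ ∘ Prod.swap)) := by
  rw [h.joined_iff, h.joined_swap_iff]
  rintro ⟨⟨-, h₁⟩, -, h₂⟩
  exact h₂.not_swap h₁

variable {D₁ D₂ : Type} {I₁ : Set (D₁ → Bool)} {I₂ : Set (D₂ → Bool)}
  {κ₁ : Corner → D₁} {κ₂ : Corner → D₂}

/-- `I` contains the constant functions and is closed under negation. -/
def IsClosedUnderNot (I : Set (D → Bool)) : Prop :=
  (∀ φ ∈ I, (fun d => !φ d) ∈ I) ∧ ∀ x, (fun _ => x) ∈ I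

theorem RowStrands.exists_eq (h : RowStrands I κ) (hI : IsClosedUnderNot I) (x : Bool) :
    ∃ φ ∈ I, φ (κ (0, 0)) = x ∧ φ (κ (0, 1)) = x ∧ φ (κ (1, 0)) = !x ∧ φ (κ (1, 1)) = !x := by
  obtain ⟨φ, hφ, h₁, h₂⟩ := h.2
  have h0 := h.1 φ hφ 0
  have h1 := h.1 φ hφ 1
  cases x
  · exact ⟨_, hI.1 φ hφ, by simp_all⟩
  · exact ⟨_, hφ, by simp_all⟩

/-- Pairs of functions that agree where the right side of the first tangle is glued to the left
side of the second. -/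
def GluedConstant (I₁ : Set (D₁ → Bool)) (κ₁ : Corner → D₁) (I₂ : Set (D₂ → Bool))
    (κ₂ : Corner → D₂) (P : (D₁ → Bool) → (D₂ → Bool) → Prop) : Prop :=
  ∀ φ₁ ∈ I₁, ∀ φ₂ ∈ I₂, (∀ r, φ₁ (κ₁ (r, 1)) = φ₂ (κ₂ (r, 0))) → P φ₁ φ₂ →
    ∃ x, (∀ d, φ₁ d = x) ∧ ∀ d, φ₂ d = x

/-- A loop of one part survives the gluing: a function that is constant on the corners of one part
extends by that constant over the other. `hP` says that the closing condition `P` allows this. -/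
theorem GluedConstant.noLoops (hI₁ : IsClosedUnderNot I₁)
    (hI₂ : IsClosedUnderNot I₂) {P : (D₁ → Bool) → (D₂ → Bool) → Prop}
    (hP : ∀ φ₁ φ₂ x, (∀ p, φ₁ (κ₁ p) = x) → (∀ p, φ₂ (κ₂ p) = x) → P φ₁ φ₂)
    (h : GluedConstant I₁ κ₁ I₂ κ₂ P) : NoLoops I₁ κ₁ ∧ NoLoops I₂ κ₂ := by
  constructor
  · intro φ hφ hc d d'
    obtain ⟨x, hx, -⟩ := h φ hφ _ (hI₂.2 (φ (κ₁ (0, 0)))) (fun r => hc _ _)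
      (hP _ _ _ (fun p => hc p (0, 0)) fun _ => rfl)
    rw [hx, hx]
  · intro φ hφ hc d d'
    obtain ⟨x, -, hx⟩ := h _ (hI₁.2 (φ (κ₂ (0, 0)))) φ hφ (fun r => hc _ _)
      (hP _ _ _ (fun _ => rfl) fun p => hc p (0, 0))
    rw [hx, hx]

theorem NoLoops.exists_const {φ₁ : D₁ → Bool} {φ₂ : D₂ → Bool} (h₁ : NoLoops I₁ κ₁)
    (h₂ : NoLoops I₂ κ₂) (hφ₁ : φ₁ ∈ I₁) (hφ₂ : φ₂ ∈ I₂) (x : Bool)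
    (hx₁ : ∀ p, φ₁ (κ₁ p) = x) (hx₂ : ∀ p, φ₂ (κ₂ p) = x) :
    ∃ x, (∀ d, φ₁ d = x) ∧ ∀ d, φ₂ d = x :=
  ⟨x, fun d => (h₁ φ₁ hφ₁ (fun p q => by rw [hx₁, hx₁]) d (κ₁ (0, 0))).trans (hx₁ _),
    fun d => (h₂ φ₂ hφ₂ (fun p q => by rw [hx₂, hx₂]) d (κ₂ (0, 0))).trans (hx₂ _)⟩

theorem gluedConstant_rows_iff (hI₁ : IsClosedUnderNot I₁)
    (hI₂ : IsClosedUnderNot I₂) (h₁ : TwoStrands I₁ κ₁) (h₂ : TwoStrands I₂ κ₂) :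
    GluedConstant I₁ κ₁ I₂ κ₂ (fun φ₁ φ₂ => ∀ r, φ₁ (κ₁ (r, 0)) = φ₂ (κ₂ (r, 1))) ↔
      (Joined I₁ κ₁ ∧ Joined I₂ (κ₂ ∘ Prod.swap)) ∨
        (Joined I₁ (κ₁ ∘ Prod.swap) ∧ Joined I₂ κ₂) := by
  rw [h₁.joined_iff, h₂.joined_iff, h₁.joined_swap_iff, h₂.joined_swap_iff]
  constructor
  · intro h
    obtain ⟨n₁, n₂⟩ := GluedConstant.noLoops hI₁ hI₂ (by intro φ₁ φ₂ x a b r; rw [a, b]) h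
    rcases h₁ with r₁ | r₁ <;> rcases h₂ with r₂ | r₂
    -- Rows with rows: an upper and a lower circle, separated by the value on the top row.
    · obtain ⟨φ₁, i₁, a⟩ := r₁.exists_eq hI₁ true
      obtain ⟨φ₂, i₂, b⟩ := r₂.exists_eq hI₂ true
      obtain ⟨x, hx, -⟩ := h φ₁ i₁ φ₂ i₂ (by simp [Fin.forall_fin_two, a, b])
        (by simp [Fin.forall_fin_two, a, b])
      have := (hx (κ₁ (0, 0))).trans (hx (κ₁ (1, 0))).symm
      simp_all
    · exact Or.inr ⟨⟨n₁, r₁⟩, n₂, r₂⟩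
    · exact Or.inl ⟨⟨n₁, r₁⟩, n₂, r₂⟩
    -- Columns with columns: one circle runs through the seam and the other through the outer sides.
    -- The second function starts with `false` because it must continue the right column of the
    -- first.
    · obtain ⟨φ₁, i₁, a⟩ := r₁.exists_eq hI₁ true
      obtain ⟨φ₂, i₂, b⟩ := r₂.exists_eq hI₂ false
      simp only [Function.comp, Prod.swap_prod_mk] at a b
      obtain ⟨x, hx, -⟩ := h φ₁ i₁ φ₂ i₂ (by simp [Fin.forall_fin_two, a, b])
        (by simp [Fin.forall_fin_two, a, b])
      have := (hx (κ₁ (0, 0))).trans (hx (κ₁ (0, 1))).symm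
      simp_all
  · rintro (⟨⟨n₁, r₁⟩, n₂, r₂⟩ | ⟨⟨n₁, r₁⟩, n₂, r₂⟩) φ₁ i₁ φ₂ i₂ g hP <;>
    · refine n₁.exists_const n₂ i₁ i₂ (φ₁ (κ₁ (0, 0))) ?_ ?_ <;>
      · have a := r₁.1 φ₁ i₁
        have b := r₂.1 φ₂ i₂
        simp only [Function.comp, Prod.swap_prod_mk, Fin.forall_fin_two, Prod.forall] at a b g hP ⊢
        grind

theorem gluedConstant_columns_iff (hI₁ : IsClosedUnderNot I₁)
    (hI₂ : IsClosedUnderNot I₂) (h₁ : TwoStrands I₁ κ₁) (h₂ : TwoStrands I₂ κ₂) :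
    GluedConstant I₁ κ₁ I₂ κ₂ (fun φ₁ φ₂ =>
        φ₁ (κ₁ (0, 0)) = φ₁ (κ₁ (1, 0)) ∧ φ₂ (κ₂ (0, 1)) = φ₂ (κ₂ (1, 1))) ↔
      Joined I₁ (κ₁ ∘ Prod.swap) ∧ Joined I₂ (κ₂ ∘ Prod.swap) := by
  rw [h₁.joined_swap_iff, h₂.joined_swap_iff]
  constructor
  · intro h
    obtain ⟨n₁, n₂⟩ := GluedConstant.noLoops hI₁ hI₂ (by intro φ₁ φ₂ x a b; simp [a, b]) h
    refine ⟨⟨n₁, h₁.resolve_right fun r₁ => ?_⟩, n₂, h₂.resolve_right fun r₂ => ?_⟩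
    -- A left column strand is closed off to a circle of its own, which `φ₁` separates from
    -- everything else.
    · obtain ⟨φ₁, i₁, a⟩ := r₁.exists_eq hI₁ true
      simp only [Function.comp, Prod.swap_prod_mk] at a
      obtain ⟨x, hx, -⟩ := h φ₁ i₁ _ (hI₂.2 false) (by simp [Fin.forall_fin_two, a]) (by simp [a])
      have := (hx (κ₁ (0, 0))).trans (hx (κ₁ (0, 1))).symm
      simp_all
    · obtain ⟨φ₂, i₂, a⟩ := r₂.exists_eq hI₂ true
      simp only [Function.comp, Prod.swap_prod_mk] at a
      obtain ⟨x, -, hx⟩ := h _ (hI₁.2 true) φ₂ i₂ (by simp [Fin.forall_fin_two, a]) (by simp [a])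
      have := (hx (κ₂ (0, 0))).trans (hx (κ₂ (0, 1))).symm
      simp_all
  · rintro ⟨⟨n₁, r₁⟩, n₂, r₂⟩ φ₁ i₁ φ₂ i₂ g hP
    refine n₁.exists_const n₂ i₁ i₂ (φ₁ (κ₁ (0, 0))) ?_ ?_ <;>
    · have a := r₁.1 φ₁ i₁
      have b := r₂.1 φ₂ i₂
      simp only [Fin.forall_fin_two, Prod.forall] at a b g hP ⊢
      grind

end Gluing

/-! ### Strands of a crossingless diagram -/

section Strands

open Finset

variable {D : Type} {e s : D → D}

/-- The edges pair the ends in the support of `φ` with opposite colours, so the total colour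
vanishes. The involution `s` cancels colours in the same way except at the corners, which it fixes;
adding both sums leaves twice the contribution of the corners. -/
theorem sum_corners_eq_zero [Fintype D] (he : Function.Involutive e) (hs : Function.Involutive s)
    {κ : Corner → D} (hκ : Function.Injective κ) (hfix : ∀ d, s d = d ↔ d ∈ Set.range κ)
    {c : D → ℝ} (hce : ∀ d, c (e d) = -c d) (hcs : ∀ d, d ∉ Set.range κ → c (s d) = -c d)
    {φ : D → Bool} (hφ : φ ∈ invariantFunctions e s) :
    ∑ p, (if φ (κ p) = true then c (κ p) else 0) = 0 := by
  classical
  set h : D → ℝ := fun d => if φ d = true then c d else 0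
  have h₁ : ∑ d, h d = 0 := by
    have : ∑ d, h (e d) = ∑ d, h d := Equiv.sum_comp he.toPerm h
    have h2 : ∀ d, h (e d) = - h d := fun d => by
      simp only [h, hφ.1 d, hce]; split_ifs <;> simp
    simp only [h2, sum_neg_distrib] at this
    linarith
  have h₂ : ∑ d, h (s d) = ∑ d, h d := Equiv.sum_comp hs.toPerm h
  have h₃ : ∀ d, h d + h (s d) = if d ∈ Set.range κ then 2 * h d else 0 := fun d => by
    split_ifs with hd
    · rw [(hfix d).2 hd]; ring
    · simp only [h, hφ.2 d, hcs d hd]; split_ifs <;> simp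
  have h₄ : ∑ d, (h d + h (s d)) = 0 := by rw [sum_add_distrib, h₂, h₁, add_zero]
  simp only [h₃] at h₄
  rw [← sum_filter, ← mul_sum] at h₄
  have h₅ : univ.filter (· ∈ Set.range κ) = univ.image κ := by ext; simp
  rw [h₅, sum_image hκ.injOn] at h₄
  change ∑ p, h (κ p) = 0
  linarith

/-- The orbit of a fixed point of an involution `s` under the group generated by involutions `e`
and `s` contains at most two fixed points of `s`. -/
theorem exists_strand (he : Function.Involutive e) (hs : Function.Involutive s) {x : D}
    (hx : s x = x) : ∃ φ ∈ invariantFunctions e s, φ x = true ∧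
      (∀ d, φ d = true → ∀ ψ ∈ invariantFunctions e s, ψ d = ψ x) ∧
      ∀ y z, φ y = true → φ z = true → s y = y → s z = z → y = x ∨ z = x ∨ y = z := by
  classical
  -- Two involutions generate a dihedral group. Since `s` fixes `x`, the orbit of `x` consists of
  -- the points `g ^ k x` with `g = e s`; there `s` acts as `k ↦ -k` and `e` as `k ↦ 1 - k`.
  let E : Equiv.Perm D := he.toPerm
  let S : Equiv.Perm D := hs.toPerm
  have hE : E⁻¹ = E := rfl
  have hS : S⁻¹ = S := rfl
  let g : Equiv.Perm D := E * S
  have hg : g⁻¹ = S * E := by simp [g, hE, hS]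
  have hSg : ∀ k : ℤ, S * g ^ k * S⁻¹ = (g ^ k)⁻¹ := fun k => by
    rw [← conj_zpow, ← inv_zpow, hg]; simp only [g, hS]; congr 1
    ext d; simp [S, E, hs d]
  have hSx : ∀ k : ℤ, s ((g ^ k) x) = (g ^ (-k)) x := fun k => by
    have := congrArg (fun f : Equiv.Perm D => f x) (hSg k)
    simp only [Equiv.Perm.mul_apply, hS] at this
    rw [zpow_neg]
    simpa [S, hx] using this
  have hEx : ∀ k : ℤ, e ((g ^ k) x) = (g ^ (1 - k)) x := fun k => by
    have : e ((g ^ k) x) = g (s ((g ^ k) x)) := by simp [g, E, S, hs _]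
    rw [this, hSx, ← Equiv.Perm.mul_apply, ← zpow_one_add]
    congr 2
  refine ⟨fun d => decide (∃ k : ℤ, (g ^ k) x = d), ⟨fun d => ?_, fun d => ?_⟩, ?_, ?_, ?_⟩
  · refine decide_eq_decide.2 ⟨?_, ?_⟩
    · rintro ⟨k, hk⟩
      exact ⟨1 - k, by rw [← hEx, hk, he d]⟩
    · rintro ⟨k, hk⟩
      exact ⟨1 - k, by rw [← hEx, hk]⟩
  · refine decide_eq_decide.2 ⟨?_, ?_⟩
    · rintro ⟨k, hk⟩
      exact ⟨-k, by rw [← hSx, hk, hs d]⟩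
    · rintro ⟨k, hk⟩
      exact ⟨-k, by rw [← hSx, hk]⟩
  · exact decide_eq_true ⟨0, rfl⟩
  · intro d hd ψ hψ
    obtain ⟨k, rfl⟩ := of_decide_eq_true hd
    have hψg : ∀ d, ψ (g d) = ψ d := fun d => (hψ.1 _).trans (hψ.2 d)
    induction k using Int.induction_on with
    | zero => rfl
    | succ k ih =>
      rw [add_comm, zpow_one_add, Equiv.Perm.mul_apply, hψg]
      exact ih (decide_eq_true ⟨_, rfl⟩)
    | pred k ih =>
      rw [← ih (decide_eq_true ⟨_, rfl⟩), ← hψg, ← Equiv.Perm.mul_apply, ← zpow_one_add]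
      congr 3
      ring
  · intro y z hy hz hsy hsz
    obtain ⟨j, rfl⟩ := of_decide_eq_true hy
    obtain ⟨k, rfl⟩ := of_decide_eq_true hz
    have key : ∀ k : ℤ, (g ^ k) x = x ↔ (Function.minimalPeriod (g • ·) x : ℤ) ∣ k := fun k =>
      MulAction.zpow_smul_eq_iff_minimalPeriod_dvd (a := g) (b := x) (n := k)
    have two : ∀ i j : ℤ, (g ^ i) x = (g ^ j) x ↔
        (Function.minimalPeriod (g • ·) x : ℤ) ∣ i - j := fun i j => by
      rw [← key, sub_eq_neg_add, zpow_add, zpow_neg, Equiv.Perm.mul_apply, Equiv.Perm.inv_eq_iff_eq]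
    rw [hSx, two] at hsy hsz
    rw [key, key, two]
    -- With period `p`, the point `g ^ j x` is fixed by `s` iff `p ∣ 2 j`. An even quotient gives
    -- `x` itself; two odd quotients give indices that are congruent modulo `p`.
    obtain ⟨a, ha⟩ := hsy
    obtain ⟨b, hb⟩ := hsz
    rcases Int.even_or_odd' a with ⟨a', rfl | rfl⟩
    · exact Or.inl ⟨-a', by linarith⟩
    rcases Int.even_or_odd' b with ⟨b', rfl | rfl⟩
    · exact Or.inr (Or.inl ⟨-b', by linarith⟩)
    · exact Or.inr (Or.inr ⟨b' - a', by linarith⟩)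

theorem sum_corners (f : Corner → ℝ) (i j : Fin 2) :
    ∑ p, f p = f (i, j) + f (Fin.rev i, j) + f (i, Fin.rev j) + f (Fin.rev i, Fin.rev j) := by
  fin_cases i <;> fin_cases j <;> simp [Fintype.sum_prod_type] <;> ring

/-- In a crossingless diagram with a checkerboard colouring `c` the four corners are joined
in pairs without crossing. -/
theorem twoStrands_of_coloring [Finite D] (he : Function.Involutive e) (hs : Function.Involutive s)
    {κ : Corner → D} (hκ : Function.Injective κ) (hfix : ∀ d, s d = d ↔ d ∈ Set.range κ)
    {c : D → ℝ} (hce : ∀ d, c (e d) = -c d) (hcs : ∀ d, d ∉ Set.range κ → c (s d) = -c d)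
    (hne : c (κ (0, 0)) ≠ 0) (h01 : c (κ (0, 1)) = -c (κ (0, 0)))
    (h10 : c (κ (1, 0)) = -c (κ (0, 0))) (h11 : c (κ (1, 1)) = c (κ (0, 0))) :
    TwoStrands (invariantFunctions e s) κ := by
  have := Fintype.ofFinite D
  have hf : ∀ p, s (κ p) = κ p := fun p => (hfix _).2 ⟨p, rfl⟩
  have key : ∀ p : Corner, ∃ φ ∈ invariantFunctions e s, φ (κ p) = true ∧
      φ (κ (Fin.rev p.1, Fin.rev p.2)) = false ∧
      ((φ (κ (Fin.rev p.1, p.2)) = true ∧ φ (κ (p.1, Fin.rev p.2)) = false ∧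
          ∀ ψ ∈ invariantFunctions e s, ψ (κ (Fin.rev p.1, p.2)) = ψ (κ p)) ∨
        (φ (κ (p.1, Fin.rev p.2)) = true ∧ φ (κ (Fin.rev p.1, p.2)) = false ∧
          ∀ ψ ∈ invariantFunctions e s, ψ (κ (p.1, Fin.rev p.2)) = ψ (κ p))) := by
    -- The strand from `p` meets at most one further corner, and the vanishing colour sum forces
    -- there to be one, of the opposite colour: a neighbour of `p`, not the diagonal corner.
    intro p
    obtain ⟨φ, hφ, hx, hψ, h2⟩ := exists_strand he hs (hf p)
    have hsum := sum_corners_eq_zero he hs hκ hfix hce hcs hφ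
    have hor : ∀ q q', φ (κ q) = true → φ (κ q') = true → q = p ∨ q' = p ∨ q = q' := by
      intro q q' a b
      simpa only [hκ.eq_iff] using h2 _ _ a b (hf q) (hf q')
    obtain ⟨i, j⟩ := p
    have o1 := hor (Fin.rev i, j) (i, Fin.rev j)
    have o2 := hor (Fin.rev i, j) (Fin.rev i, Fin.rev j)
    have o3 := hor (i, Fin.rev j) (Fin.rev i, Fin.rev j)
    have hr : ∀ i : Fin 2, Fin.rev i ≠ i := by decide
    simp only [Prod.mk.injEq, hr, (hr _).symm, and_true, and_false, or_false,
      imp_false, Bool.not_eq_true] at o1 o2 o3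
    obtain ⟨c1, c2, c3, c0⟩ : c (κ (Fin.rev i, j)) = -c (κ (i, j)) ∧
        c (κ (i, Fin.rev j)) = -c (κ (i, j)) ∧ c (κ (Fin.rev i, Fin.rev j)) = c (κ (i, j)) ∧
        c (κ (i, j)) ≠ 0 := by
      fin_cases i <;> fin_cases j <;> simp [h01, h10, h11, hne]
    rw [sum_corners _ i j, c1, c2, c3, if_pos hx] at hsum
    refine ⟨φ, hφ, hx, ?_⟩
    have q1 := hψ (κ (Fin.rev i, j))
    have q2 := hψ (κ (i, Fin.rev j))
    dsimp only
    generalize φ (κ (Fin.rev i, j)) = B at *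
    generalize φ (κ (i, Fin.rev j)) = C at *
    generalize φ (κ (Fin.rev i, Fin.rev j)) = E at *
    clear hψ h2 hor hce hcs
    cases B <;> cases C <;> cases E <;> simp_all
  -- The strands from NW and SE determine everything. If one followed a row and the other a column,
  -- they would share a corner and so join NW with SE.
  obtain ⟨φ, hφ, a1, a2, a3⟩ := key (0, 0)
  obtain ⟨φ₁, hφ₁, b1, b2, b3⟩ := key (1, 1)
  simp only [Fin.rev_zero, Fin.reduceLast, Fin.isValue, Fin.reduceRev] at *
  rcases a3 with ⟨u, v, w⟩ | ⟨u, v, w⟩ <;> rcases b3 with ⟨u', v', w'⟩ | ⟨u', v', w'⟩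
  · refine Or.inr ⟨fun ψ hψ => ?_, φ, hφ, ?_⟩
    · simp [Fin.forall_fin_two, w ψ hψ, w' ψ hψ]
    · simp_all
  · have := w' φ hφ
    simp_all
  · have := w' φ hφ
    simp_all
  · refine Or.inl ⟨fun ψ hψ => ?_, φ, hφ, ?_⟩
    · simp [Fin.forall_fin_two, w ψ hψ, w' ψ hψ]
    · simp_all

end Strands

/-! ### Checkerboard colourings of planar diagrams -/

section Coloring

open Module

variable {D : Type}

/-- The real functions that are constant along a relation. -/
def constantAlong (r : D → D → Prop) : Submodule ℝ (D → ℝ) where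
  carrier := {g | ∀ d d', r d d' → g d = g d'}
  add_mem' ha hb d d' h := by simp [ha d d' h, hb d d' h]
  zero_mem' := by simp
  smul_mem' t g hg d d' h := by simp [hg d d' h]

theorem finrank_constantAlong [Finite D] (r : D → D → Prop) :
    finrank ℝ (constantAlong r) = Nat.card (Quot r) := by
  have := Fintype.ofFinite (Quot r)
  let L : (Quot r → ℝ) ≃ₗ[ℝ] constantAlong r :=
    { toFun := fun g => ⟨fun d => g (Quot.mk r d), fun d d' h => by exact congrArg g (Quot.sound h)⟩
      invFun := fun g => Quot.lift g.1 g.2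
      map_add' := fun _ _ => rfl
      map_smul' := fun _ _ => rfl
      left_inv := fun g => by ext q; induction q using Quot.ind; rfl
      right_inv := fun g => rfl }
  rw [← L.finrank_eq, finrank_fintype_fun_eq_card, Nat.card_eq_fintype_card]

/-- The functions that change sign under `f`. -/
def alternating (f : D → D) : Submodule ℝ (D → ℝ) where
  carrier := {g | ∀ d, g (f d) = -g d}
  add_mem' ha hb d := by simp [ha d, hb d]; ring
  zero_mem' := by simp
  smul_mem' t g hg d := by simp [hg d]

theorem mem_alternating {f : D → D} {g : D → ℝ} : g ∈ alternating f ↔ ∀ d, g (f d) = -g d :=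
  Iff.rfl

theorem mem_constantAlong_graph {f : D → D} {g : D → ℝ} :
    g ∈ constantAlong (fun d d' => d' = f d) ↔ ∀ d, g (f d) = g d :=
  ⟨fun h d => (h d _ rfl).symm, fun h d d' e => by rw [e, h]⟩

/-- If some sign function alternates along the cycles of `f`, then there are as many alternating
functions as cycles. -/
theorem finrank_alternating [Finite D] {f : D → D} {s : D → ℝ} (hs : ∀ d, s (f d) = -s d)
    (hs2 : ∀ d, s d * s d = 1) : finrank ℝ (alternating f) = numCycles f := by
  rw [numCycles, ← finrank_constantAlong]
  let M : (D → ℝ) →ₗ[ℝ] (D → ℝ) :=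
    { toFun := fun g d => s d * g d
      map_add' := fun g h => by ext d; simp [mul_add]
      map_smul' := fun t g => by ext d; simp; ring }
  have hM : ∀ g, M (M g) = g := fun g => by ext d; simp [M, ← mul_assoc, hs2]
  have hinj : Function.Injective M := Function.LeftInverse.injective hM
  have : (alternating f).map M = constantAlong (fun d d' => d' = f d) := by
    ext g
    rw [mem_constantAlong_graph, Submodule.mem_map]
    constructor
    · rintro ⟨h, hh, rfl⟩ d
      simp [M, hs, mem_alternating.1 hh d]
    · intro h
      exact ⟨M g, fun d => by simp [M, hs, h], hM g⟩
  rw [← this, ← (Submodule.equivMapOfInjective M hinj _).finrank_eq]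

theorem finrank_map_add_finrank_inf {V : Type*} [AddCommGroup V] [Module ℝ V]
    [FiniteDimensional ℝ V] (f : V →ₗ[ℝ] V) (W : Submodule ℝ V) :
    finrank ℝ (W.map f) + finrank ℝ (W ⊓ LinearMap.ker f : Submodule ℝ V) = finrank ℝ W := by
  have h := LinearMap.finrank_range_add_finrank_ker (f.domRestrict W)
  rw [LinearMap.range_domRestrict, LinearMap.ker_domRestrict] at h
  rw [← h, inf_comm, ← Submodule.finrank_map_subtype_eq W, Submodule.map_comap_subtype, inf_comm]

/-- A map on a closed surface of genus zero with a sign function that alternates around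
the vertices has a checkerboard colouring: a function that is nowhere zero and changes
sign along edges and around vertices. -/
theorem exists_coloring [Finite D] {e ρ : D → D} (he : Function.Involutive e)
    (hρ : Function.Bijective ρ) {s : D → ℝ} (hs : ∀ d, s (ρ d) = -s d) (hs2 : ∀ d, s d * s d = 1)
    (hgenus : numCycles ρ + numCycles (fun d => ρ (e d)) =
      numCycles e + 2 * Nat.card (Quot fun d d' => d' = e d ∨ d' = ρ d)) :
    ∃ c : D → ℝ, (∀ d, c d ≠ 0) ∧ (∀ d, c (e d) = -c d) ∧ ∀ d, c (ρ d) = -c d := by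
  classical
  have := Fintype.ofFinite D
  let r : D → D → Prop := fun d d' => d' = e d ∨ d' = ρ d
  let K : Submodule ℝ (D → ℝ) := alternating e ⊓ alternating ρ
  -- The colourings form `K`. Vertex-alternating functions (dimension V) and face functions
  -- (dimension F) are both mapped by `δ` to edge functions (dimension E), in both cases with kernel
  -- `K`.
  let δ : (D → ℝ) →ₗ[ℝ] (D → ℝ) :=
    { toFun := fun g d => g d + g (e d)
      map_add' := fun g h => by ext d; simp; ring
      map_smul' := fun t g => by ext d; simp; ring }
  have hδ : LinearMap.ker δ = alternating e := by
    ext g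
    simp only [LinearMap.mem_ker, mem_alternating, funext_iff, δ, LinearMap.coe_mk, AddHom.coe_mk,
      Pi.zero_apply]
    exact forall_congr' fun d => by rw [add_comm, add_eq_zero_iff_eq_neg]
  let F := constantAlong (fun d d' => d' = ρ (e d))
  have hF : ∀ {f}, f ∈ F → ∀ d, f (ρ d) = f (e d) := fun {f} hf d => by
    have := mem_constantAlong_graph.1 hf (e d)
    rwa [he d] at this
  have hV := finrank_map_add_finrank_inf δ (alternating ρ)
  have hFf := finrank_map_add_finrank_inf δ F
  have hK1 : alternating ρ ⊓ LinearMap.ker δ = K := by rw [hδ, inf_comm]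
  have hK2 : F ⊓ LinearMap.ker δ = K := by
    rw [hδ]
    ext g
    simp only [K, Submodule.mem_inf]
    constructor
    · rintro ⟨a, b⟩
      exact ⟨b, fun d => by rw [hF a, b d]⟩
    · rintro ⟨a, b⟩
      refine ⟨mem_constantAlong_graph.2 fun d => ?_, a⟩
      rw [b, a, neg_neg]
  rw [hK1, finrank_alternating hs hs2] at hV
  rw [hK2, finrank_constantAlong] at hFf
  have hW : ∀ g, δ g ∈ constantAlong (fun d d' => d' = e d) := fun g =>
    mem_constantAlong_graph.2 fun d => by simp [δ, he d, add_comm]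
  -- The two images are orthogonal: `f ∘ e = f ∘ ρ` for a face function, while `v` changes sign
  -- under `ρ`.
  have horth : ∀ v ∈ alternating ρ, ∀ f ∈ F, ∑ d, δ v d * δ f d = 0 := by
    intro v hv f hf
    have h1 : ∑ d, v (e d) * f d = ∑ d, v d * f (e d) := by
      rw [← Equiv.sum_comp he.toPerm]
      simp [he _]
    have h2 : ∑ d, v (e d) * f (e d) = ∑ d, v d * f d :=
      Equiv.sum_comp he.toPerm fun d => v d * f d
    have h3 : ∑ d, v d * f (e d) = -∑ d, v d * f d := by
      rw [← Equiv.sum_comp (Equiv.ofBijective ρ hρ) fun d => v d * f d, ← Finset.sum_neg_distrib]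
      refine Finset.sum_congr rfl fun d _ => ?_
      simp [mem_alternating.1 hv d, hF hf d]
    simp only [δ, LinearMap.coe_mk, AddHom.coe_mk, add_mul, mul_add, Finset.sum_add_distrib]
    rw [h1, h2, h3]
    ring
  have hdisj : Disjoint ((alternating ρ).map δ) (F.map δ) := by
    rw [Submodule.disjoint_def]
    rintro x ⟨v, hv, rfl⟩ ⟨f, hf, hfv⟩
    have h0 := horth v hv f hf
    rw [hfv, Finset.sum_eq_zero_iff_of_nonneg fun d _ => mul_self_nonneg _] at h0
    ext d
    simpa using h0 d (Finset.mem_univ d)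
  have hle : finrank ℝ ((alternating ρ).map δ) + finrank ℝ (F.map δ) ≤ numCycles e := by
    rw [numCycles, ← finrank_constantAlong, ← Submodule.finrank_sup_add_finrank_inf_eq,
      hdisj.eq_bot, finrank_bot, add_zero]
    refine Submodule.finrank_mono (sup_le ?_ ?_)
    · rintro _ ⟨g, -, rfl⟩
      exact hW g
    · rintro _ ⟨g, -, rfl⟩
      exact hW g
  -- Orthogonality gives (V - dim K) + (F - dim K) ≤ E, and V - E + F is twice the number of
  -- components.
  have hKle : Nat.card (Quot r) ≤ finrank ℝ K := by
    simp only [numCycles] at *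
    change _ = _ + 2 * Nat.card (Quot r) at hgenus
    omega
  have := Fintype.ofFinite (Quot r)
  -- The absolute value of a colouring is constant on components, so evaluation at representatives
  -- is injective; by the dimension bound it is onto, and the value 1 can be prescribed on all
  -- components.
  let ev : K →ₗ[ℝ] (Quot r → ℝ) :=
    { toFun := fun g q => g.1 q.out
      map_add' := fun _ _ => rfl
      map_smul' := fun _ _ => rfl }
  have habs : ∀ g ∈ K, ∀ d, |g d| = |g (Quot.mk r d).out| := by
    intro g hg d
    let a : Quot r → ℝ := Quot.lift (fun d => |g d|) (by
      rintro d d' (rfl | rfl)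
      · simp [hg.1 d]
      · simp [hg.2 d])
    change a (Quot.mk r d) = a (Quot.mk r (Quot.mk r d).out)
    rw [Quot.out_eq]
  have hinj : Function.Injective ev := by
    rw [← LinearMap.ker_eq_bot, LinearMap.ker_eq_bot']
    intro g hg
    ext d
    have h1 := habs g.1 g.2 d
    have h2 : g.1 (Quot.mk r d).out = 0 := congrFun hg (Quot.mk r d)
    simpa [h2] using h1
  have hsurj : Function.Surjective ev := by
    refine (LinearMap.injective_iff_surjective_of_finrank_eq_finrank ?_).1 hinj
    refine le_antisymm (LinearMap.finrank_le_finrank_of_injective hinj) ?_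
    rwa [finrank_fintype_fun_eq_card, ← Nat.card_eq_fintype_card]
  obtain ⟨c, hc⟩ := hsurj fun _ => 1
  refine ⟨c.1, fun d h0 => ?_, c.2.1, c.2.2⟩
  have h1 := habs c.1 c.2 d
  have h2 : c.1 (Quot.mk r d).out = 1 := congrFun hc (Quot.mk r d)
  simp [h0, h2] at h1

end Coloring

/-! ### Colourings of tangle diagrams and their split states -/

section Diagrams

variable {n : ℕ} {C J : Type}

instance [Finite C] [Finite J] : Finite (Dart n C J) :=
  Finite.of_injective (β := Corner ⊕ (Fin n × Corner) ⊕ (C × Fin 4) ⊕ (J × Fin 2))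
    (fun
      | .outer p => .inl p
      | .hole i p => .inr (.inl (i, p))
      | .crossing c k => .inr (.inr (.inl (c, k)))
      | .joint j b => .inr (.inr (.inr (j, b))))
    (by rintro (_ | _ | _ | _) (_ | _ | _ | _) <;> simp)

instance [Finite C] [Finite J] : Finite (LinkDart C J) :=
  Finite.of_injective (β := (C × Fin 4) ⊕ (J × Fin 2))
    (fun
      | .crossing c k => .inl (c, k)
      | .joint j b => .inr (j, b))
    (by rintro (_ | _) (_ | _) <;> simp)

theorem rotation_bijective :
    Function.Bijective (rotation : Dart n C J → Dart n C J) := by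
  refine Function.bijective_iff_has_inverse.2 ⟨fun
    | .outer p => .outer p.ccw
    | .hole i p => .hole i p.cw
    | .crossing c k => .crossing c (k - 1)
    | .joint j b => .joint j (Fin.rev b), ?_, ?_⟩ <;>
  · rintro (_ | _ | _ | _) <;> simp [rotation, Corner.cw, Corner.ccw]

/-- A sign that alternates around each vertex. -/
def alternatingSign : Dart n C J → ℝ
  | .outer p => (-1) ^ (p.1 + p.2 : ℕ)
  | .hole _ p => (-1) ^ (p.1 + p.2 : ℕ)
  | .crossing _ k => (-1) ^ (k : ℕ)
  | .joint _ b => (-1) ^ (b : ℕ)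

theorem alternatingSign_rotation (d : Dart n C J) :
    alternatingSign (rotation d) = -alternatingSign d := by
  rcases d with ⟨i, j⟩ | ⟨_, i, j⟩ | ⟨_, k⟩ | ⟨_, b⟩
  · fin_cases i <;> fin_cases j <;> simp [rotation, alternatingSign, Corner.cw]
  · fin_cases i <;> fin_cases j <;> simp [rotation, alternatingSign, Corner.ccw]
  · fin_cases k <;> norm_num [rotation, alternatingSign, Fin.val_add]
  · fin_cases b <;> simp [rotation, alternatingSign]

theorem alternatingSign_mul_self (d : Dart n C J) :
    alternatingSign d * alternatingSign d = 1 := by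
  rcases d with _ | _ | _ | _ <;> simp [alternatingSign, ← mul_pow]

theorem TangleDiagram.IsPlanar.exists_coloring {T : TangleDiagram n} (hT : T.IsPlanar) :
    ∃ c : Dart n T.Crossing T.Joint → ℝ, (∀ d, c d ≠ 0) ∧ (∀ d, c (T.edge d) = -c d) ∧
      ∀ d, c (rotation d) = -c d :=
  PuncturedTangle.exists_coloring T.edge_edge rotation_bijective alternatingSign_rotation
    alternatingSign_mul_self hT

/-- The other end of a strand of a crossingless tangle whose strands join the corners of the same
column, or of the same row. -/
def mate (sameColumn : Bool) (p : Corner) : Corner :=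
  if sameColumn then (Fin.rev p.1, p.2) else (p.1, Fin.rev p.2)

/-- How the ends at the crossings, the joints and the filled holes are joined. The corners of the
outer circle are left alone. -/
def interior (α : Fin n → Fin 2) (σ : C → Bool) : Dart n C J → Dart n C J
  | .outer p => .outer p
  | .hole i p => .hole i (mate (α i == 0) p)
  | .crossing c k => .crossing c (LinkDiagram.split (σ c) k)
  | .joint j b => .joint j (Fin.rev b)

theorem mate_ne (b : Bool) (p : Corner) : mate b p ≠ p := by
  revert b p; decide

theorem split_ne (b : Bool) (k : Fin 4) : LinkDiagram.split b k ≠ k := by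
  revert b k; decide

theorem interior_involutive (α : Fin n → Fin 2) (σ : C → Bool) :
    Function.Involutive (interior α σ : Dart n C J → Dart n C J) := by
  have h : ∀ b p, mate b (mate b p) = p := by decide
  have h' : ∀ b k, LinkDiagram.split b (LinkDiagram.split b k) = k := by decide
  rintro (_ | _ | _ | _) <;> simp [interior, h, h']

theorem interior_eq_self_iff (α : Fin n → Fin 2) (σ : C → Bool) (d : Dart n C J) :
    interior α σ d = d ↔ d ∈ Set.range Dart.outer := by
  have h : ∀ b : Fin 2, Fin.rev b ≠ b := by decide
  rcases d with _ | _ | _ | _ <;> simp [interior, h, mate_ne, split_ne]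

/-- Both splittings and both fillings join ends that are neighbours in the cyclic order around their
vertex. -/
theorem coloring_interior {c : Dart n C J → ℝ} (hc : ∀ d, c (rotation d) = -c d)
    (α : Fin n → Fin 2) (σ : C → Bool) (d : Dart n C J) (hd : d ∉ Set.range Dart.outer) :
    c (interior α σ d) = -c d := by
  have hm : ∀ b p, mate b p = p.ccw ∨ (mate b p).ccw = p := by decide
  have hs : ∀ b k, LinkDiagram.split b k = k + 1 ∨ LinkDiagram.split b k + 1 = k := by decide
  have key : interior α σ d = rotation d ∨ rotation (interior α σ d) = d := by
    rcases d with p | ⟨i, p⟩ | ⟨x, k⟩ | ⟨j, b⟩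
    · exact absurd ⟨p, rfl⟩ hd
    · simpa [interior, rotation] using hm _ p
    · simpa [interior, rotation] using hs _ k
    · exact Or.inl rfl
  rcases key with h | h
  · rw [h, hc]
  · have := hc (interior α σ d)
    rw [h] at this
    rw [this, neg_neg]

/-- The functions that are constant on the strands and circles of a split diagram of a tangle. -/
abbrev TangleDiagram.stateFunctions (T : TangleDiagram n) (α : Fin n → Fin 2)
    (σ : T.Crossing → Bool) : Set (Dart n T.Crossing T.Joint → Bool) :=
  invariantFunctions T.edge (interior α σ)

theorem TangleDiagram.IsPlanar.twoStrands {T : TangleDiagram n} (hT : T.IsPlanar)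
    (α : Fin n → Fin 2) (σ : T.Crossing → Bool) :
    TwoStrands (T.stateFunctions α σ) Dart.outer := by
  obtain ⟨c, h0, he, hr⟩ := hT.exists_coloring
  have h1 := hr (.outer (0, 0))
  have h2 := hr (.outer (0, 1))
  have h3 := hr (.outer (1, 1))
  simp only [rotation, Corner.cw, Fin.rev_zero, Fin.reduceLast, Fin.isValue, Fin.reduceRev]
    at h1 h2 h3
  refine twoStrands_of_coloring T.edge_edge (interior_involutive α σ)
    (fun p q h => by simpa using h) (interior_eq_self_iff α σ) he
    (coloring_interior hr α σ) (h0 _) h1 ?_ ?_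
  · rw [h3, h2, h1, neg_neg]
  · rw [h2, h1, neg_neg]

end Diagrams

/-! ### Brackets as sums over connected states -/

/-- The indicator function of a class separates it from every other class. This replaces counting
circles by a condition on Boolean functions. -/
theorem subsingleton_quot_iff {D : Type} (r : D → D → Prop) :
    Subsingleton (Quot r) ↔
      ∀ ψ : D → Bool, (∀ d d', r d d' → ψ d = ψ d') → ∀ d d', ψ d = ψ d' := by
  classical
  constructor
  · intro _ ψ hψ d d'
    exact congrArg (Quot.lift ψ hψ) (Subsingleton.elim (Quot.mk r d) (Quot.mk r d'))
  · refine fun h => ⟨fun q q' => ?_⟩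
    induction q using Quot.ind with | mk d
    induction q' using Quot.ind with | mk d'
    have := h (fun x => decide (Quot.mk r x = Quot.mk r d))
      (fun x y hxy => by rw [Quot.sound hxy]) d d'
    simpa [eq_comm] using this

section Closure

variable {n : ℕ}

/-- The corners, listed so that the closure with label `r` joins those of each row. -/
def closingCorner {C J : Type} (r : Fin 2) (p : Corner) : Dart n C J :=
  .outer ((TangleDiagram.pairCorners (r == 1)).symm p)

theorem pairCorners_mate (b : Bool) (p : Corner) :
    TangleDiagram.pairCorners b (mate b p) =
      ((TangleDiagram.pairCorners b p).1, Fin.rev (TangleDiagram.pairCorners b p).2) := by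
  cases b <;> rfl

theorem pairCorners_symm_rev (b : Bool) (s t : Fin 2) :
    (TangleDiagram.pairCorners b).symm (s, Fin.rev t) =
      mate b ((TangleDiagram.pairCorners b).symm (s, t)) := by
  cases b <;> rfl

/-- Under `closeDart`, `smooth` acts as `interior` except at the outer corners. There the closing
arcs add exactly the condition that appears in `Joined`. -/
theorem TangleDiagram.subsingleton_circles_iff (T : TangleDiagram n) (r : Fin 2)
    (α : Fin n → Fin 2) (σ : (T.closure r α).State) :
    Subsingleton (Quot fun d e => e = (T.closure r α).edge d ∨ e = (T.closure r α).smooth σ d) ↔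
      Joined (T.stateFunctions α σ) (closingCorner r) := by
  rw [subsingleton_quot_iff]
  constructor
  · intro h φ hφ hr d d'
    have key : φ ((closeDart r α).symm (closeDart r α d)) =
        φ ((closeDart r α).symm (closeDart r α d')) :=
      h (φ ∘ (closeDart r α).symm) ?_ (closeDart r α d) (closeDart r α d')
    · simpa using key
    rintro x _ (rfl | rfl)
    · have := hφ.1 ((closeDart r α).symm x)
      change _ = φ ((closeDart r α).symm (closeDart r α (T.edge ((closeDart r α).symm x))))
      rw [Equiv.symm_apply_apply]
      exact this.symm
    · rcases x with ⟨c, k⟩ | ⟨(j | ⟨i, s⟩ | s), b⟩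
      · exact (hφ.2 (.crossing c k)).symm
      · exact (hφ.2 (.joint j b)).symm
      · change φ (.hole i _) = φ (.hole i _)
        rw [pairCorners_symm_rev]
        exact (hφ.2 (.hole i _)).symm
      · change φ (closingCorner r (s, b)) = φ (closingCorner r (s, Fin.rev b))
        have := hr s
        fin_cases b
        · exact this
        · exact this.symm
  · intro h ψ hψ d d'
    have key : ψ (closeDart r α ((closeDart r α).symm d)) =
        ψ (closeDart r α ((closeDart r α).symm d')) :=
      h (ψ ∘ closeDart r α) ⟨fun x => ?_, fun x => ?_⟩ (fun s => ?_)
        ((closeDart r α).symm d) ((closeDart r α).symm d')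
    · exact (congrArg ψ ((closeDart r α).apply_symm_apply d)).symm.trans
        (key.trans (congrArg ψ ((closeDart r α).apply_symm_apply d')))
    · have : ψ (closeDart r α x) =
          ψ (closeDart r α (T.edge ((closeDart r α).symm (closeDart r α x)))) :=
        hψ (closeDart r α x) _ (Or.inl rfl)
      rw [Equiv.symm_apply_apply] at this
      exact this.symm
    · rcases x with p | ⟨i, p⟩ | ⟨c, k⟩ | ⟨j, b⟩
      · rfl
      · have := hψ (closeDart r α (.hole i p)) _ (Or.inr rfl)
        refine Eq.trans ?_ this.symm
        change ψ (.joint (.inr (.inl (i, _))) _) = ψ (.joint (.inr (.inl (i, _))) _)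
        rw [pairCorners_mate]
      · exact (hψ (closeDart r α (.crossing c k)) _ (Or.inr rfl)).symm
      · exact (hψ (closeDart r α (.joint j b)) _ (Or.inr rfl)).symm
    · have := hψ (.joint (.inr (.inr s)) 0) _ (Or.inr rfl)
      have hc : ∀ b, closeDart r α (closingCorner r (s, b)) =
          (.joint (.inr (.inr s)) b :
            LinkDart T.Crossing (T.Joint ⊕ (Fin n × Fin 2) ⊕ Fin 2)) := fun b => by
        simp [closingCorner, closeDart]
      exact (congrArg ψ (hc 0)).trans (this.trans (congrArg ψ (hc 1)).symm)

/-- The contribution of the crossings to the term of a state in the Kauffman bracket. -/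
noncomputable def stateWeight {C : Type} [Fintype C] (σ : C → Bool) : ℂ :=
  ∏ c, if σ c = true then Complex.exp (Complex.I * Real.pi / 4)
    else (Complex.exp (Complex.I * Real.pi / 4))⁻¹

theorem stateWeight_eq {C : Type} [Fintype C] (σ : C → Bool) : stateWeight σ =
    Complex.exp (Complex.I * Real.pi / 4) ^ (Finset.univ.filter fun c => σ c = true).card *
      (Complex.exp (Complex.I * Real.pi / 4))⁻¹ ^
        (Finset.univ.filter fun c => σ c = false).card := by
  simp only [stateWeight, Finset.prod_ite, Finset.prod_const, Bool.not_eq_true]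

theorem stateWeight_sum {C₁ C₂ : Type} [Fintype C₁] [Fintype C₂] (σ₁ : C₁ → Bool)
    (σ₂ : C₂ → Bool) : stateWeight (Sum.elim σ₁ σ₂) = stateWeight σ₁ * stateWeight σ₂ := by
  exact Fintype.prod_sum_type _

theorem exp_pi_div_four_sq : Complex.exp (Complex.I * Real.pi / 4) ^ 2 = Complex.I := by
  rw [← Complex.exp_nat_mul]
  refine Eq.trans (congrArg Complex.exp ?_) Complex.exp_pi_div_two_mul_I
  push_cast
  ring

open Classical in
theorem TangleDiagram.bracket_closure (T : TangleDiagram n) (r : Fin 2) (α : Fin n → Fin 2) :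
    (T.closure r α).bracket = ∑ σ : T.Crossing → Bool,
      stateWeight σ * if Joined (T.stateFunctions α σ) (closingCorner r) then 1 else 0 := by
  refine Finset.sum_congr rfl fun σ _ => ?_
  have hδ : -Complex.exp (Complex.I * Real.pi / 4) ^ 2 -
      (Complex.exp (Complex.I * Real.pi / 4))⁻¹ ^ 2 = 0 := by
    rw [inv_pow, exp_pi_div_four_sq, Complex.inv_I]
    ring
  rw [hδ]
  congr 1
  · exact (stateWeight_eq σ).symm
  -- The power `0 ^ (d - 1)` is 1 iff the truncated difference is 0, that is `d ≤ 1`. Finiteness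
  -- makes `Nat.card` a true count.
  · have : Finite (LinkDart (T.closure r α).Crossing (T.closure r α).Joint) := inferInstance
    rw [← T.subsingleton_circles_iff, ← Finite.card_le_one_iff_subsingleton, zero_pow_eq]
    congr 1
    exact propext Nat.sub_eq_zero_iff_le

end Closure

/-! ### Connect sums -/

section Sums

variable {k₁ k₂ : ℕ}

theorem isClosedUnderNot_invariantFunctions {D : Type} (e s : D → D) :
    IsClosedUnderNot (invariantFunctions e s) :=
  ⟨fun φ hφ => ⟨fun d => by simp [hφ.1 d], fun d => by simp [hφ.2 d]⟩,
    fun x => ⟨fun _ => rfl, fun _ => rfl⟩⟩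

/-- A function on the glued set of ends is a pair of functions on the parts, by `Sum.elim` and
restriction; `hI` and `hP` translate the conditions. -/
theorem joined_iff_gluedConstant {D₁ D₂ D : Type} (g : D₁ ⊕ D₂ ≃ D) {I₁ : Set (D₁ → Bool)}
    {κ₁ : Corner → D₁} {I₂ : Set (D₂ → Bool)} {κ₂ : Corner → D₂} {I : Set (D → Bool)}
    {κ : Corner → D} {P : (D₁ → Bool) → (D₂ → Bool) → Prop}
    (hI : ∀ φ, φ ∈ I ↔ (fun d => φ (g (.inl d))) ∈ I₁ ∧ (fun d => φ (g (.inr d))) ∈ I₂ ∧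
      ∀ r, φ (g (.inl (κ₁ (r, 1)))) = φ (g (.inr (κ₂ (r, 0)))))
    (hP : ∀ φ : D → Bool, (∀ r, φ (κ (r, 0)) = φ (κ (r, 1))) ↔
      P (fun d => φ (g (.inl d))) (fun d => φ (g (.inr d)))) :
    Joined I κ ↔ GluedConstant I₁ κ₁ I₂ κ₂ P := by
  constructor
  · intro h φ₁ h₁ φ₂ h₂ hg hφ
    have := h (Sum.elim φ₁ φ₂ ∘ g.symm) ((hI _).2 ⟨by simpa using h₁, by simpa using h₂,
      by simpa only [Function.comp, Equiv.symm_apply_apply, Sum.elim_inl, Sum.elim_inr] using hg⟩)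
      ((hP _).2 (by simpa using hφ))
    have key : ∀ x y, Sum.elim φ₁ φ₂ x = Sum.elim φ₁ φ₂ y := fun x y => by
      simpa using this (g x) (g y)
    exact ⟨φ₁ (κ₁ (0, 0)), fun d => key (.inl d) (.inl _), fun d => key (.inr d) (.inl _)⟩
  · intro h φ hφ hr d d'
    obtain ⟨h₁, h₂, hg⟩ := (hI φ).1 hφ
    obtain ⟨x, hx₁, hx₂⟩ := h _ h₁ _ h₂ hg ((hP φ).1 hr)
    have key : ∀ y, φ (g y) = x := by rintro (y | y) <;> simp [hx₁, hx₂]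
    rw [← g.apply_symm_apply d, ← g.apply_symm_apply d', key, key]

variable (T₁ : TangleDiagram k₁) (T₂ : TangleDiagram k₂) (α : Fin (k₁ + k₂) → Fin 2)
  (σ₁ : T₁.Crossing → Bool) (σ₂ : T₂.Crossing → Bool)

/-- The labels of the holes of the first tangle. -/
abbrev leftLabels (α : Fin (k₁ + k₂) → Fin 2) : Fin k₁ → Fin 2 := fun i => α (Fin.castAdd k₂ i)

/-- The labels of the holes of the second tangle. -/
abbrev rightLabels (α : Fin (k₁ + k₂) → Fin 2) : Fin k₂ → Fin 2 := fun i => α (Fin.natAdd k₁ i)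

open TangleDiagram

/-- Edges and interior joinings of the sum come from the parts, except at the seam: the glued
corners, fixed by `interior` in the parts, are exchanged at the new joints. -/
theorem mem_stateFunctions_hsum (φ : Dart (k₁ + k₂) (T₁.Crossing ⊕ T₂.Crossing)
      ((T₁.Joint ⊕ T₂.Joint) ⊕ Fin 2) → Bool) :
    φ ∈ (T₁.hsum T₂).stateFunctions α (Sum.elim σ₁ σ₂) ↔
      (fun d => φ (glueHorizontal (.inl d))) ∈ T₁.stateFunctions (leftLabels α) σ₁ ∧
      (fun d => φ (glueHorizontal (.inr d))) ∈ T₂.stateFunctions (rightLabels α) σ₂ ∧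
      ∀ r, φ (glueHorizontal (.inl (.outer (r, 1)))) =
        φ (glueHorizontal (.inr (.outer (r, 0)))) := by
  have hedge : ∀ x, (T₁.hsum T₂).edge (glueHorizontal x) =
      glueHorizontal (Sum.map T₁.edge T₂.edge x) := fun x => by simp [hsum]
  constructor
  · rintro ⟨he, hs⟩
    refine ⟨⟨fun d => ?_, ?_⟩, ⟨fun d => ?_, ?_⟩, fun r => (hs (.joint (.inr r) 1))⟩
    · have := he (glueHorizontal (.inl d))
      rwa [hedge] at this
    · rintro (p | ⟨i, p⟩ | ⟨c, k⟩ | ⟨j, b⟩)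
      · rfl
      · exact hs (.hole (Fin.castAdd k₂ i) p)
      · exact hs (.crossing (.inl c) k)
      · exact hs (.joint (.inl (.inl j)) b)
    · have := he (glueHorizontal (.inr d))
      rwa [hedge] at this
    · rintro (p | ⟨i, p⟩ | ⟨c, k⟩ | ⟨j, b⟩)
      · rfl
      · exact hs (.hole (Fin.natAdd k₁ i) p)
      · exact hs (.crossing (.inr c) k)
      · exact hs (.joint (.inl (.inr j)) b)
  · rintro ⟨⟨he₁, hs₁⟩, ⟨he₂, hs₂⟩, hg⟩
    refine ⟨fun d => ?_, ?_⟩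
    · obtain ⟨x, rfl⟩ := glueHorizontal.surjective d
      rw [hedge]
      rcases x with x | x
      · exact he₁ x
      · exact he₂ x
    · rintro (p | ⟨i, p⟩ | ⟨(c | c), k⟩ | ⟨((j | j) | r), b⟩)
      · rfl
      · refine Fin.addCases (fun i => ?_) (fun i => ?_) i
        · exact hs₁ (.hole i p)
        · exact hs₂ (.hole i p)
      · exact hs₁ (.crossing c k)
      · exact hs₂ (.crossing c k)
      · exact hs₁ (.joint j b)
      · exact hs₂ (.joint j b)
      · fin_cases b
        · exact (hg r).symm
        · exact hg r

theorem mem_stateFunctions_vsum (φ : Dart (k₁ + k₂) (T₁.Crossing ⊕ T₂.Crossing)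
      ((T₁.Joint ⊕ T₂.Joint) ⊕ Fin 2) → Bool) :
    φ ∈ (T₁.vsum T₂).stateFunctions α (Sum.elim σ₁ σ₂) ↔
      (fun d => φ (glueVertical (.inl d))) ∈ T₁.stateFunctions (leftLabels α) σ₁ ∧
      (fun d => φ (glueVertical (.inr d))) ∈ T₂.stateFunctions (rightLabels α) σ₂ ∧
      ∀ c, φ (glueVertical (.inl (.outer (1, c)))) =
        φ (glueVertical (.inr (.outer (0, c)))) := by
  have hedge : ∀ x, (T₁.vsum T₂).edge (glueVertical x) =
      glueVertical (Sum.map T₁.edge T₂.edge x) := fun x => by simp [vsum]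
  constructor
  · rintro ⟨he, hs⟩
    refine ⟨⟨fun d => ?_, ?_⟩, ⟨fun d => ?_, ?_⟩, fun r => (hs (.joint (.inr r) 1))⟩
    · have := he (glueVertical (.inl d))
      rwa [hedge] at this
    · rintro (p | ⟨i, p⟩ | ⟨c, k⟩ | ⟨j, b⟩)
      · rfl
      · exact hs (.hole (Fin.castAdd k₂ i) p)
      · exact hs (.crossing (.inl c) k)
      · exact hs (.joint (.inl (.inl j)) b)
    · have := he (glueVertical (.inr d))
      rwa [hedge] at this
    · rintro (p | ⟨i, p⟩ | ⟨c, k⟩ | ⟨j, b⟩)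
      · rfl
      · exact hs (.hole (Fin.natAdd k₁ i) p)
      · exact hs (.crossing (.inr c) k)
      · exact hs (.joint (.inl (.inr j)) b)
  · rintro ⟨⟨he₁, hs₁⟩, ⟨he₂, hs₂⟩, hg⟩
    refine ⟨fun d => ?_, ?_⟩
    · obtain ⟨x, rfl⟩ := glueVertical.surjective d
      rw [hedge]
      rcases x with x | x
      · exact he₁ x
      · exact he₂ x
    · rintro (p | ⟨i, p⟩ | ⟨(c | c), k⟩ | ⟨((j | j) | r), b⟩)
      · rfl
      · refine Fin.addCases (fun i => ?_) (fun i => ?_) i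
        · exact hs₁ (.hole i p)
        · exact hs₂ (.hole i p)
      · exact hs₁ (.crossing c k)
      · exact hs₂ (.crossing c k)
      · exact hs₁ (.joint j b)
      · exact hs₂ (.joint j b)
      · fin_cases b
        · exact (hg r).symm
        · exact hg r

theorem sum_states {C₁ C₂ : Type} [Fintype C₁] [DecidableEq C₁] [Fintype C₂] [DecidableEq C₂]
    (f : (C₁ ⊕ C₂ → Bool) → ℂ) :
    ∑ σ, f σ = ∑ σ₁ : C₁ → Bool, ∑ σ₂ : C₂ → Bool, f (Sum.elim σ₁ σ₂) := by
  rw [← Fintype.sum_prod_type', ← Equiv.sum_comp (Equiv.sumArrowEquivProdArrow C₁ C₂ Bool).symm]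
  rfl

theorem sum_mul_ite_and {ι₁ ι₂ : Type} [Fintype ι₁] [Fintype ι₂] (w₁ : ι₁ → ℂ) (w₂ : ι₂ → ℂ)
    (P₁ : ι₁ → Prop) (P₂ : ι₂ → Prop) [DecidablePred P₁] [DecidablePred P₂] :
    ∑ i, ∑ j, w₁ i * w₂ j * (if P₁ i ∧ P₂ j then 1 else 0) =
      (∑ i, w₁ i * if P₁ i then 1 else 0) * ∑ j, w₂ j * if P₂ j then 1 else 0 := by
  rw [Finset.sum_mul_sum]
  refine Finset.sum_congr rfl fun i _ => Finset.sum_congr rfl fun j _ => ?_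
  by_cases P₁ i <;> by_cases P₂ j <;> simp [*]

theorem ite_or_eq_add {p q : Prop} [Decidable p] [Decidable q] (h : ¬ (p ∧ q)) :
    (if p ∨ q then 1 else 0 : ℂ) = (if p then 1 else 0) + if q then 1 else 0 := by
  by_cases p <;> by_cases q <;> simp_all

variable {T₁ T₂}

theorem joined_hsum_zero_iff (hT₁ : T₁.IsPlanar) (hT₂ : T₂.IsPlanar) :
    Joined ((T₁.hsum T₂).stateFunctions α (Sum.elim σ₁ σ₂)) (closingCorner 0) ↔
      (Joined (T₁.stateFunctions (leftLabels α) σ₁) (closingCorner 0) ∧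
        Joined (T₂.stateFunctions (rightLabels α) σ₂) (closingCorner 1)) ∨
      (Joined (T₁.stateFunctions (leftLabels α) σ₁) (closingCorner 1) ∧
        Joined (T₂.stateFunctions (rightLabels α) σ₂) (closingCorner 0)) := by
  refine Iff.trans ?_ (gluedConstant_rows_iff (κ₁ := Dart.outer)
    (κ₂ := Dart.outer) (isClosedUnderNot_invariantFunctions _ _)
    (isClosedUnderNot_invariantFunctions _ _) (hT₁.twoStrands _ _) (hT₂.twoStrands _ _))
  exact joined_iff_gluedConstant (κ₁ := Dart.outer) (κ₂ := Dart.outer)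
    glueHorizontal (mem_stateFunctions_hsum T₁ T₂ α σ₁ σ₂)
    (fun φ => Iff.rfl)

theorem joined_hsum_one_iff (hT₁ : T₁.IsPlanar) (hT₂ : T₂.IsPlanar) :
    Joined ((T₁.hsum T₂).stateFunctions α (Sum.elim σ₁ σ₂)) (closingCorner 1) ↔
      Joined (T₁.stateFunctions (leftLabels α) σ₁) (closingCorner 1) ∧
        Joined (T₂.stateFunctions (rightLabels α) σ₂) (closingCorner 1) := by
  refine Iff.trans ?_ (gluedConstant_columns_iff (κ₁ := Dart.outer)
    (κ₂ := Dart.outer) (isClosedUnderNot_invariantFunctions _ _)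
    (isClosedUnderNot_invariantFunctions _ _) (hT₁.twoStrands _ _) (hT₂.twoStrands _ _))
  exact joined_iff_gluedConstant (κ₁ := Dart.outer) (κ₂ := Dart.outer)
    glueHorizontal (mem_stateFunctions_hsum T₁ T₂ α σ₁ σ₂)
    (fun φ => Fin.forall_fin_two)

theorem joined_vsum_one_iff (hT₁ : T₁.IsPlanar) (hT₂ : T₂.IsPlanar) :
    Joined ((T₁.vsum T₂).stateFunctions α (Sum.elim σ₁ σ₂)) (closingCorner 1) ↔
      (Joined (T₁.stateFunctions (leftLabels α) σ₁) (closingCorner 1) ∧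
        Joined (T₂.stateFunctions (rightLabels α) σ₂) (closingCorner 0)) ∨
      (Joined (T₁.stateFunctions (leftLabels α) σ₁) (closingCorner 0) ∧
        Joined (T₂.stateFunctions (rightLabels α) σ₂) (closingCorner 1)) := by
  -- Exchanging rows and columns turns the vertical sum into the horizontal one and swaps the two
  -- closures.
  refine Iff.trans ?_ (gluedConstant_rows_iff (κ₁ := Dart.outer ∘ Prod.swap)
    (κ₂ := Dart.outer ∘ Prod.swap) (isClosedUnderNot_invariantFunctions _ _)
    (isClosedUnderNot_invariantFunctions _ _) (hT₁.twoStrands _ _).swap (hT₂.twoStrands _ _).swap)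
  exact joined_iff_gluedConstant (κ₁ := Dart.outer ∘ Prod.swap) (κ₂ := Dart.outer ∘ Prod.swap)
    glueVertical (mem_stateFunctions_vsum T₁ T₂ α σ₁ σ₂) (fun φ => Iff.rfl)

theorem joined_vsum_zero_iff (hT₁ : T₁.IsPlanar) (hT₂ : T₂.IsPlanar) :
    Joined ((T₁.vsum T₂).stateFunctions α (Sum.elim σ₁ σ₂)) (closingCorner 0) ↔
      Joined (T₁.stateFunctions (leftLabels α) σ₁) (closingCorner 0) ∧
        Joined (T₂.stateFunctions (rightLabels α) σ₂) (closingCorner 0) := by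
  refine Iff.trans ?_ (gluedConstant_columns_iff (κ₁ := Dart.outer ∘ Prod.swap)
    (κ₂ := Dart.outer ∘ Prod.swap) (isClosedUnderNot_invariantFunctions _ _)
    (isClosedUnderNot_invariantFunctions _ _) (hT₁.twoStrands _ _).swap (hT₂.twoStrands _ _).swap)
  exact joined_iff_gluedConstant (κ₁ := Dart.outer ∘ Prod.swap) (κ₂ := Dart.outer ∘ Prod.swap)
    glueVertical (mem_stateFunctions_vsum T₁ T₂ α σ₁ σ₂) (fun φ => Fin.forall_fin_two)

theorem bracket_hsum_zero (hT₁ : T₁.IsPlanar) (hT₂ : T₂.IsPlanar) :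
    ((T₁.hsum T₂).closure 0 α).bracket =
      (T₁.closure 0 (leftLabels α)).bracket * (T₂.closure 1 (rightLabels α)).bracket +
        (T₁.closure 1 (leftLabels α)).bracket * (T₂.closure 0 (rightLabels α)).bracket := by
  classical
  simp only [bracket_closure]
  rw [← sum_mul_ite_and, ← sum_mul_ite_and, ← Finset.sum_add_distrib]
  refine (sum_states _).trans ?_
  refine Finset.sum_congr rfl fun σ₁ _ => ?_
  rw [← Finset.sum_add_distrib]
  refine Finset.sum_congr rfl fun σ₂ _ => ?_
  rw [← mul_add, ← ite_or_eq_add]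
  · exact congrArg₂ _ (stateWeight_sum σ₁ σ₂)
      (if_congr (joined_hsum_zero_iff α σ₁ σ₂ hT₁ hT₂) rfl rfl)
  · exact fun h => (hT₁.twoStrands _ σ₁).not_joined_and ⟨h.1.1, h.2.1⟩

theorem bracket_hsum_one (hT₁ : T₁.IsPlanar) (hT₂ : T₂.IsPlanar) :
    ((T₁.hsum T₂).closure 1 α).bracket =
      (T₁.closure 1 (leftLabels α)).bracket * (T₂.closure 1 (rightLabels α)).bracket := by
  classical
  simp only [bracket_closure]
  rw [← sum_mul_ite_and]
  refine (sum_states _).trans ?_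
  refine Finset.sum_congr rfl fun σ₁ _ => Finset.sum_congr rfl fun σ₂ _ => ?_
  exact congrArg₂ _ (stateWeight_sum σ₁ σ₂)
    (if_congr (joined_hsum_one_iff α σ₁ σ₂ hT₁ hT₂) rfl rfl)

theorem bracket_vsum_one (hT₁ : T₁.IsPlanar) (hT₂ : T₂.IsPlanar) :
    ((T₁.vsum T₂).closure 1 α).bracket =
      (T₁.closure 1 (leftLabels α)).bracket * (T₂.closure 0 (rightLabels α)).bracket +
        (T₁.closure 0 (leftLabels α)).bracket * (T₂.closure 1 (rightLabels α)).bracket := by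
  classical
  simp only [bracket_closure]
  rw [← sum_mul_ite_and, ← sum_mul_ite_and, ← Finset.sum_add_distrib]
  refine (sum_states _).trans ?_
  refine Finset.sum_congr rfl fun σ₁ _ => ?_
  rw [← Finset.sum_add_distrib]
  refine Finset.sum_congr rfl fun σ₂ _ => ?_
  rw [← mul_add, ← ite_or_eq_add]
  · exact congrArg₂ _ (stateWeight_sum σ₁ σ₂)
      (if_congr (joined_vsum_one_iff α σ₁ σ₂ hT₁ hT₂) rfl rfl)
  · exact fun h => (hT₁.twoStrands _ σ₁).not_joined_and ⟨h.2.1, h.1.1⟩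

theorem bracket_vsum_zero (hT₁ : T₁.IsPlanar) (hT₂ : T₂.IsPlanar) :
    ((T₁.vsum T₂).closure 0 α).bracket =
      (T₁.closure 0 (leftLabels α)).bracket * (T₂.closure 0 (rightLabels α)).bracket := by
  classical
  simp only [bracket_closure]
  rw [← sum_mul_ite_and]
  refine (sum_states _).trans ?_
  refine Finset.sum_congr rfl fun σ₁ _ => Finset.sum_congr rfl fun σ₂ _ => ?_
  exact congrArg₂ _ (stateWeight_sum σ₁ σ₂)
    (if_congr (joined_vsum_zero_iff α σ₁ σ₂ hT₁ hT₂) rfl rfl)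

end Sums

/-! ### The dictionary order -/

/-- The recursion peels off the leading binary digit, so coordinate `j` is bit `n - 1 - j`. Quotient
and remainder by `2 ^ k₂` then cut a tuple into the labels of the two tangles. -/
theorem dictTuple_eq_testBit {n i : ℕ} (hi : i < 2 ^ n) (j : Fin n) :
    dictTuple n i j = if i.testBit (n - 1 - j) then 1 else 0 := by
  induction n generalizing i with
  | zero => exact j.elim0
  | succ n ih =>
    refine Fin.cases ?_ (fun j => ?_) j
    · simp only [dictTuple, Fin.cons_zero, Fin.val_zero, Nat.add_sub_cancel, Nat.sub_zero]
      by_cases h : i < 2 ^ n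
      · simp [h, Nat.testBit_lt_two_pow h]
      · have : i.testBit n = true := by
          rw [← Nat.sub_add_cancel (not_lt.1 h), add_comm, Nat.testBit_two_pow_add_eq,
            Nat.testBit_lt_two_pow (by rw [pow_succ] at hi; omega)]
          rfl
        simp [h, this]
    · have hj : n + 1 - 1 - (j.succ : ℕ) = n - 1 - j := by simp; omega
      rw [hj, dictTuple, Fin.cons_succ, ih (Nat.mod_lt _ (by positivity)),
        Nat.testBit_mod_two_pow]
      have : n - 1 - (j : ℕ) < n := by have := j.2; omega
      simp [this]

theorem tSeq_eq_sum {n i : ℕ} (hi : i < 2 ^ n) :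
    tSeq n i = ∑ j, (dictTuple n i j : ℕ) := by
  induction n generalizing i with
  | zero => rfl
  | succ n ih =>
    rw [Fin.sum_univ_succ, tSeq]
    simp only [dictTuple, Fin.cons_zero, Fin.cons_succ]
    rw [← ih (Nat.mod_lt _ (by positivity))]
    by_cases h : i < 2 ^ n
    · simp [h, Nat.mod_eq_of_lt h]
    · have : i % 2 ^ n = i - 2 ^ n := by
        rw [Nat.mod_eq_sub_mod (not_lt.1 h), Nat.mod_eq_of_lt (by rw [pow_succ] at hi; omega)]
      simp [h, this, add_comm]

section Columns

variable {k₁ k₂ : ℕ}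

theorem columnPair_fst (c : Fin (2 ^ (k₁ + k₂))) :
    ((columnPair k₁ k₂ c).1 : ℕ) = c / 2 ^ k₂ := by
  simp [columnPair]

theorem columnPair_snd (c : Fin (2 ^ (k₁ + k₂))) :
    ((columnPair k₁ k₂ c).2 : ℕ) = c % 2 ^ k₂ := by
  simp [columnPair]

theorem leftLabels_dictTuple (c : Fin (2 ^ (k₁ + k₂))) :
    leftLabels (dictTuple (k₁ + k₂) c) = dictTuple k₁ (columnPair k₁ k₂ c).1 := by
  ext1 j
  rw [leftLabels, dictTuple_eq_testBit c.2, dictTuple_eq_testBit (Fin.is_lt _), columnPair_fst,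
    Nat.testBit_div_two_pow, Fin.val_castAdd]
  congr 3
  have := j.2
  omega

theorem rightLabels_dictTuple (c : Fin (2 ^ (k₁ + k₂))) :
    rightLabels (dictTuple (k₁ + k₂) c) = dictTuple k₂ (columnPair k₁ k₂ c).2 := by
  ext1 j
  rw [rightLabels, dictTuple_eq_testBit c.2, dictTuple_eq_testBit (Fin.is_lt _), columnPair_snd,
    Nat.testBit_mod_two_pow, Fin.val_natAdd]
  have h₁ : k₂ - 1 - (j : ℕ) < k₂ := by have := j.2; omega
  have h₂ : k₁ + k₂ - 1 - (k₁ + (j : ℕ)) = k₂ - 1 - j := by omega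
  simp [h₁, h₂]

theorem tSeq_add (c : Fin (2 ^ (k₁ + k₂))) :
    tSeq (k₁ + k₂) c = tSeq k₁ (columnPair k₁ k₂ c).1 + tSeq k₂ (columnPair k₁ k₂ c).2 := by
  rw [tSeq_eq_sum c.2, tSeq_eq_sum (Fin.is_lt _), tSeq_eq_sum (Fin.is_lt _),
    ← leftLabels_dictTuple, ← rightLabels_dictTuple, Fin.sum_univ_add]

end Columns

/-! ### The invariant -/

/-- At a nonzero entry of `M` the eighth powers of two integers agree, so the entries agree up to
sign; this forces `u = ±1`. -/
theorem mem_pmClass_of_smul_eq {m n : ℕ} {M N : Matrix (Fin m) (Fin n) ℤ} {u : ℂ}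
    (hu : u ^ 8 = 1) (h : ∀ i j, (N i j : ℂ) = u * M i j) : N ∈ pmClass M := by
  by_cases hM : M = 0
  · left
    ext i j
    have := h i j
    simp only [hM, Matrix.zero_apply, Int.cast_zero, mul_zero, Int.cast_eq_zero] at this ⊢
    exact this
  · obtain ⟨i, j, hij⟩ : ∃ i j, M i j ≠ 0 := by
      by_contra! h0
      exact hM (Matrix.ext h0)
    have h8 : N i j ^ 8 = M i j ^ 8 := by
      have := congrArg (· ^ 8) (h i j)
      simp only [mul_pow, hu, one_mul] at this
      exact_mod_cast this
    have hm : (M i j : ℂ) ≠ 0 := Int.cast_ne_zero.2 hij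
    have h1 := h i j
    rcases (pow_eq_pow_iff_cases (n := 8)).1 h8 with h' | h' | ⟨h', -⟩
    · omega
    · rw [h'] at h1
      have hu1 : u = 1 := mul_right_cancel₀ hm (by rw [← h1, one_mul])
      left
      ext i j
      have := h i j
      rw [hu1, one_mul] at this
      exact_mod_cast this
    · rw [h', Int.cast_neg] at h1
      have hu1 : u = -1 := mul_right_cancel₀ hm (by rw [← h1, neg_one_mul])
      right
      ext i j
      have := h i j
      rw [hu1, neg_one_mul] at this
      exact_mod_cast this

theorem tangleInvariant_eq_pmClass {n : ℕ} {T : TangleDiagram n}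
    {M : Matrix (Fin 2) (Fin (2 ^ n)) ℤ} (hM : M ∈ tangleInvariant T) :
    tangleInvariant T = pmClass M := by
  obtain ⟨z, hz, h⟩ := hM
  have hz0 : z ≠ 0 := by rintro rfl; norm_num at hz
  ext N
  constructor
  · rintro ⟨w, hw, h'⟩
    refine mem_pmClass_of_smul_eq (u := w / z) (by rw [div_pow, hw, hz, div_one]) fun i j => ?_
    have e₁ := congrFun (congrFun h i) j
    have e₂ := congrFun (congrFun h' i) j
    simp only [Matrix.map_apply, Matrix.smul_apply, smul_eq_mul] at e₁ e₂
    rw [e₁, e₂]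
    field_simp
  · rintro (rfl | rfl)
    · exact ⟨z, hz, h⟩
    · refine ⟨-z, by rw [← hz]; ring, ?_⟩
      rw [neg_smul, ← h]
      ext i j
      simp

end PuncturedTangle

theorem theorem3p9 (k₁ k₂ : ℕ)
    (T₁ : PuncturedTangle.TangleDiagram k₁) (T₂ : PuncturedTangle.TangleDiagram k₂)
    (hT₁ : T₁.IsPlanar) (hT₂ : T₂.IsPlanar)
    (a : Matrix (Fin 2) (Fin (2 ^ k₁)) ℤ) (b : Matrix (Fin 2) (Fin (2 ^ k₂)) ℤ)
    (ha : PuncturedTangle.tangleInvariant T₁ = PuncturedTangle.pmClass a)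
    (hb : PuncturedTangle.tangleInvariant T₂ = PuncturedTangle.pmClass b) :
    PuncturedTangle.tangleInvariant (T₁.hsum T₂) =
        PuncturedTangle.pmClass (Matrix.of ![
          fun c => a 0 (PuncturedTangle.columnPair k₁ k₂ c).1 *
              b 1 (PuncturedTangle.columnPair k₁ k₂ c).2 +
            a 1 (PuncturedTangle.columnPair k₁ k₂ c).1 *
              b 0 (PuncturedTangle.columnPair k₁ k₂ c).2,
          fun c => a 1 (PuncturedTangle.columnPair k₁ k₂ c).1 *
              b 1 (PuncturedTangle.columnPair k₁ k₂ c).2]) ∧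
      PuncturedTangle.tangleInvariant (T₁.vsum T₂) =
        PuncturedTangle.pmClass (Matrix.of ![
          fun c => a 0 (PuncturedTangle.columnPair k₁ k₂ c).1 *
              b 0 (PuncturedTangle.columnPair k₁ k₂ c).2,
          fun c => a 1 (PuncturedTangle.columnPair k₁ k₂ c).1 *
              b 0 (PuncturedTangle.columnPair k₁ k₂ c).2 +
            a 0 (PuncturedTangle.columnPair k₁ k₂ c).1 *
              b 1 (PuncturedTangle.columnPair k₁ k₂ c).2]) := by
  open PuncturedTangle in
  have ha' : a ∈ tangleInvariant T₁ := ha ▸ Or.inl rfl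
  have hb' : b ∈ tangleInvariant T₂ := hb ▸ Or.inl rfl
  obtain ⟨z, hz, h⟩ := ha'
  obtain ⟨w, hw, h'⟩ := hb'
  have e₁ : ∀ r i, (a r i : ℂ) = z * ((-Complex.I) ^ tSeq k₁ i * Complex.I ^ (r : ℕ) *
      (T₁.closure r (dictTuple k₁ i)).bracket) := fun r i => congrFun (congrFun h r) i
  have e₂ : ∀ r i, (b r i : ℂ) = w * ((-Complex.I) ^ tSeq k₂ i * Complex.I ^ (r : ℕ) *
      (T₂.closure r (dictTuple k₂ i)).bracket) := fun r i => congrFun (congrFun h' r) i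
  -- In the horizontal sum both rows of products carry one factor `i` more than `bracketMatrix`
  -- does: `i` instead of 1 in the first row, `i²` instead of `i` in the second. In the vertical sum
  -- the factors match.
  have h8 : (z * w * Complex.I) ^ 8 = 1 := by
    rw [mul_pow, mul_pow, hz, hw, show 8 = 4 * 2 from rfl, pow_mul, Complex.I_pow_four]
    norm_num
  constructor
  · refine tangleInvariant_eq_pmClass ⟨z * w * Complex.I, h8, ?_⟩
    ext r c
    fin_cases r <;>
    · simp [bracketMatrix, e₁, e₂, bracket_hsum_zero _ hT₁ hT₂, bracket_hsum_one _ hT₁ hT₂,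
        leftLabels_dictTuple, rightLabels_dictTuple, tSeq_add, pow_add]
      ring
  · refine tangleInvariant_eq_pmClass ⟨z * w, by rw [mul_pow, hz, hw, one_mul], ?_⟩
    ext r c
    fin_cases r <;>
    · simp [bracketMatrix, e₁, e₂, bracket_vsum_zero _ hT₁ hT₂, bracket_vsum_one _ hT₁ hT₂,
        leftLabels_dictTuple, rightLabels_dictTuple, tSeq_add, pow_add]
      ring
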